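/- Let $(\Omega,\mathcal A,\mu)$ be a $\sigma$-finite measure space and let $\{\mathcal Q_n : n\in\mathbb Z\}$ be partitions of $\Omega$ into measurable sets with $0<\mu(Q)<\infty$ for all $Q\in\mathcal Q_n$, such that each $Q\in\mathcal Q_n$ is a union of sets in $\mathcal Q_{n+1}$ (a set may belong to several $\mathcal Q_n$, and may split into arbitrarily many, even infinitely many, pieces), and such that $\mathcal Q=\bigcup_n\mathcal Q_n$ generates $\mathcal A$. The elements of $\mathcal Q$ are called atoms. The parent of $Q\in\mathcal Q$ is the minimal atom strictly containing $Q$ (if there is one), and $\mathrm{ch}(P)$ is the set of atoms with parent $P$. Write $\langle f\rangle_Q=\mu(Q)^{-1}\int_Q f\,d\mu$ and $\Delta_Pf=\sum_{Q\in \mathrm{ch}(P)}(\langle f\rangle_Q-\langle f\rangle_P)\mathbf 1_Q$. For real or complex scalars $\epsilon_P$ with $|\epsilon_P|\le 1$ $(P\in\mathcal Q)$ put $$Tf=\sum_{P\in\mathcal Q}\epsilon_P\Delta_Pf,\qquad T_\sharp f=\sup_{Q'\in\mathcal Q}\Bigl|\sum_{Q\in\mathcal Q,\ Q\supseteq Q'}\epsilon_Q\Delta_Qf\Bigr|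 ,$$ where $Tf(x)$ is understood as $\lim_{n\to\infty}\sum_{P\in\mathcal Q,\ P\supseteq Q_n(x)}\epsilon_P\Delta_Pf(x)$, with $Q_n(x)$ the element of $\mathcal Q_n$ containing $x$. A collection $\mathcal S\subseteq\mathcal Q$ is sparse if for every $P\in\mathcal S$ the maximal elements $Q$ of $\mathcal S$ that are strictly contained in $P$ satisfy $\sum_Q\mu(Q)\le\frac12\mu(P)$. **Theorem.** There is an absolute constant $C>0$ such that, in every such setting, for every real- or complex-valued $f\in L^1(\mu)$ supported on an atom $Q_0\in\mathcal Q$ and all $(\epsilon_P)$ as above, the sums over $Q\supseteq Q'$ converge absolutely and the limit defining $Tf$ exists $\mu$-almost everywhere, and there is a sparse collection $\mathcal S$, depending on $T$ and $f$, such that $\mu$-almost everywhere $$\mathbf 1_{Q_0}|Tf|\le C\sum_{P\in\mathcal S}\langle|f|\rangle_P\mathbf 1_P \qquad\text{and}\qquad \mathbf 1_{Q_0}\,T_\sharp f\le C\sum_{P\in\mathcal S}\langle|f|\rangle_P\mathbf 1_P .$$ -/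

import Mathlib

open MeasureTheory Filter Topology
open scoped ENNReal NNReal

noncomputable section

/-- A discrete filtration `(𝒬 n)`, `n ∈ ℤ`, of a measure space by partitions into atoms of positive
finite measure, each partition refining the previous one, which together generate the `σ`-algebra.
An atom may split into arbitrarily (even infinitely) many pieces, or not split at all. -/
structure PartitionFiltration (Ω : Type*) [m : MeasurableSpace Ω] (μ : Measure Ω) where
  part : ℤ → Set (Set Ω)
  isPartition : ∀ n, Setoid.IsPartition (part n)
  measurableSet : ∀ n, ∀ Q ∈ part n, MeasurableSet Q
  measure_pos : ∀ n, ∀ Q ∈ part n, 0 < μ Q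
  measure_lt_top : ∀ n, ∀ Q ∈ part n, μ Q < ∞
  refines : ∀ n, ∀ Q ∈ part n, ∃ 𝒞 ⊆ part (n + 1), Q = ⋃₀ 𝒞
  generates : MeasurableSpace.generateFrom (⋃ n, part n) = m

namespace PartitionFiltration

variable {Ω : Type*} [MeasurableSpace Ω] {μ : Measure Ω} (𝒬 : PartitionFiltration Ω μ)

/-- The tree `𝒬 = ⋃ₙ 𝒬ₙ` of all atoms. -/
def atoms : Set (Set Ω) := ⋃ n, 𝒬.part n

/-- `P` is the parent of `Q`: the minimal atom strictly containing `Q`. -/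
def IsParent (P Q : Set Ω) : Prop := Minimal (fun R => R ∈ 𝒬.atoms ∧ Q ⊂ R) P

/-- The children of `P`: the atoms whose parent is `P`. -/
def children (P : Set Ω) : Set (Set Ω) := {Q | Q ∈ 𝒬.atoms ∧ 𝒬.IsParent P Q}

/-- The atom of the `n`-th partition containing `x` (a union over exactly one set). -/
def cell (n : ℤ) (x : Ω) : Set Ω := ⋃₀ {Q | Q ∈ 𝒬.part n ∧ x ∈ Q}

/-- The collection `S` of atoms is sparse: for every `P ∈ S`, the maximal elements of `S` strictly
contained in `P` have total measure at most `μ P / 2`. (Hence almost every point of a `P ∈ S` lies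
in only finitely many members of `S` contained in `P`, while measures at least double along
increasing chains in `S`: a sparse operator applied to an integrable function is finite a.e.) -/
def IsSparse (S : Set (Set Ω)) : Prop :=
  S ⊆ 𝒬.atoms ∧
    ∀ P ∈ S, ∑' Q : {Q : Set Ω // Maximal (fun R => R ∈ S ∧ R ⊂ P) Q}, μ (Q : Set Ω) ≤ μ P / 2

variable {𝕜 : Type*} [RCLike 𝕜]

/-- The martingale difference `Δ_P f = ∑_{Q ∈ ch(P)} (⟨f⟩_Q - ⟨f⟩_P) 1_Q`; at each point at most
one term of the sum is nonzero. -/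
def martingaleDiff (P : Set Ω) (f : Ω → 𝕜) (x : Ω) : 𝕜 :=
  ∑' Q : 𝒬.children P,
    (Q : Set Ω).indicator (fun _ => (⨍ y in (Q : Set Ω), f y ∂μ) - ⨍ y in P, f y ∂μ) x

/-- The truncation `∑_{Q ⊇ Q'} ε_Q Δ_Q f` of the martingale transform at the atom `Q'`. -/
def truncation (ε : Set Ω → 𝕜) (f : Ω → 𝕜) (Q' : Set Ω) (x : Ω) : 𝕜 :=
  ∑' Q : {Q : Set Ω // Q ∈ 𝒬.atoms ∧ Q' ⊆ Q}, ε Q * 𝒬.martingaleDiff Q f x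

/-- The martingale transform `T f = ∑_{P ∈ 𝒬} ε_P Δ_P f`. At the point `x` only the atoms
containing `x` contribute, and the sum is the limit of its truncations as these atoms shrink. -/
def transform (ε : Set Ω → 𝕜) (f : Ω → 𝕜) (x : Ω) : 𝕜 :=
  limUnder atTop (fun n : ℤ => 𝒬.truncation ε f (𝒬.cell n x) x)

/-- The maximal truncation `T_♯ f = sup_{Q'} |∑_{Q ⊇ Q'} ε_Q Δ_Q f|`. -/
def maximalTruncation (ε : Set Ω → 𝕜) (f : Ω → 𝕜) (x : Ω) : ℝ≥0∞ :=
  ⨆ Q' ∈ 𝒬.atoms, ‖𝒬.truncation ε f Q' x‖ₑ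

end PartitionFiltration

/-- The positive operator `g ↦ ∑_{P ∈ S} ⟨g⟩_P 1_P` on nonnegative functions. -/
def sparseOperator {Ω : Type*} [MeasurableSpace Ω] (μ : Measure Ω) (S : Set (Set Ω))
    (g : Ω → ℝ≥0∞) (x : Ω) : ℝ≥0∞ :=
  ∑' P : S, (P : Set Ω).indicator (fun _ => ⨍⁻ y in (P : Set Ω), g y ∂μ) x

end

/-! The engine is Burkholder's weak-type inequality for maximal martingale transforms, localized to
an atom and then iterated by stopping. For a nonnegative martingale `f` and a height `L`, the
process `min f L` is a supermartingale with values in `[0, L]` that agrees with `f` wherever `f`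
never exceeds `L`. In its Doob decomposition, transforms of the martingale part have energy at most
`2 L 𝔼 f₀`, and the compensator has total mass at most `𝔼 f₀`. Doob's and Markov's inequalities then
give `measure_exists_transformSum_le`; real, imaginary, positive and negative parts reduce the
general case to this one.

For an atom `P` with `a = ⟨|f|⟩_P`, stop at the first cell inside `P` where the transform restarted
at `P`, or the average of `|f|`, exceeds a large multiple of `a`. By the weak-type bound the
stopping cells cover at most half of `P`, so iterating from `Q₀` yields a sparse family. Without any
doubling the jump into a stopping cell `R` is not controlled by `a`, but it is at most `⟨|f|⟩_R`
plus the previous, still good, average. The term `⟨|f|⟩_R` is charged to `R`, itself a member of the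
family, and the transform is restarted there (`enorm_sum_increment_add_le`).

Above `Q₀` the average of `f` over a cell is `∫ f` divided by the measure of the cell, so the norms
of the increments telescope and sum to at most `⟨|f|⟩_{Q₀}`. Finally, every truncation at a point is
zero or a prefix sum of increments along the cells of that point (`hasSum_truncation`). This gives
the bound for `T_♯`, and almost everywhere convergence transfers it to `T`. -/

noncomputable section

set_option linter.unusedSectionVars false

/-! ### Transforms of supermartingales and nonnegative martingales on a finite measure space. -/

namespace MartingaleTransform

variable {Ω : Type*} {m0 : MeasurableSpace Ω} {μ : Measure Ω} [IsFiniteMeasure μ]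

theorem integral_mul_condExp_of_bound {m : MeasurableSpace Ω} (hm : m ≤ m0) {X Y : Ω → ℝ} {c : ℝ}
    (hY : StronglyMeasurable[m] Y) (hYc : ∀ᵐ x ∂μ, |Y x| ≤ c) (hX : Integrable X μ) :
    ∫ x, Y x * (μ[X | m]) x ∂μ = ∫ x, Y x * X x ∂μ := by
  have h := condExp_stronglyMeasurable_mul_of_bound hm hY hX c hYc
  calc ∫ x, Y x * (μ[X | m]) x ∂μ = ∫ x, (μ[Y * X | m]) x ∂μ := integral_congr_ae h.symm
    _ = ∫ x, Y x * X x ∂μ := integral_condExp hm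

theorem integrable_of_abs_le {X : Ω → ℝ} {c : ℝ} (hX : AEStronglyMeasurable X μ)
    (hXc : ∀ᵐ x ∂μ, |X x| ≤ c) : Integrable X μ :=
  Integrable.of_bound hX c hXc

/-- The increments of the martingale part of `g`. -/
def innovation (g : ℕ → Ω → ℝ) (ℱ : Filtration ℕ m0) (μ : Measure Ω) (k : ℕ) (x : Ω) : ℝ :=
  (g (k + 1) x - g k x) - (μ[g (k + 1) - g k | ℱ k]) x

/-- The martingale transform of the martingale part of `g`. -/
def innovationSum (ε g : ℕ → Ω → ℝ) (ℱ : Filtration ℕ m0) (μ : Measure Ω) (n : ℕ) (x : Ω) : ℝ :=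
  ∑ k ∈ Finset.range n, ε k x * innovation g ℱ μ k x

/-- `g` is an adapted process with values in `[0, L]` that decreases in conditional mean. -/
structure IsBoundedSupermartingale (g : ℕ → Ω → ℝ) (ℱ : Filtration ℕ m0) (μ : Measure Ω)
    (L : ℝ) : Prop where
  adapted : StronglyAdapted ℱ g
  nonneg : ∀ n x, 0 ≤ g n x
  le : ∀ n x, g n x ≤ L
  bound_nonneg : 0 ≤ L
  condExp_le : ∀ n, μ[g (n + 1) - g n | ℱ n] ≤ᵐ[μ] 0

/-- `ε` is an adapted process with values in `[-1, 1]`. -/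
structure IsMultiplier (ε : ℕ → Ω → ℝ) (ℱ : Filtration ℕ m0) : Prop where
  adapted : StronglyAdapted ℱ ε
  abs_le : ∀ n x, |ε n x| ≤ 1

variable {ℱ : Filtration ℕ m0} {g ε : ℕ → Ω → ℝ} {L : ℝ}

namespace IsBoundedSupermartingale

theorem integrable (h : IsBoundedSupermartingale g ℱ μ L) (k : ℕ) : Integrable (g k) μ :=
  integrable_of_abs_le ((h.adapted k).mono (ℱ.le k)).aestronglyMeasurable
    (ae_of_all _ fun x => abs_le.2 ⟨by linarith [h.nonneg k x, h.le k x], h.le k x⟩)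

theorem abs_increment_le (h : IsBoundedSupermartingale g ℱ μ L) (k : ℕ) (x : Ω) :
    |g (k + 1) x - g k x| ≤ L :=
  abs_sub_le_iff.2 ⟨by linarith [h.nonneg k x, h.le (k + 1) x],
    by linarith [h.nonneg (k + 1) x, h.le k x]⟩

theorem integrable_increment (h : IsBoundedSupermartingale g ℱ μ L) (k : ℕ) :
    Integrable (g (k + 1) - g k) μ :=
  (h.integrable (k + 1)).sub (h.integrable k)

theorem abs_condExp_increment_le (h : IsBoundedSupermartingale g ℱ μ L) (k : ℕ) :
    ∀ᵐ x ∂μ, |(μ[g (k + 1) - g k | ℱ k]) x| ≤ L :=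
  ae_bdd_abs_condExp_of_ae_bdd_abs (ae_of_all _ fun x => h.abs_increment_le k x)

theorem innovation_stronglyMeasurable (h : IsBoundedSupermartingale g ℱ μ L) (k : ℕ) :
    StronglyMeasurable[ℱ (k + 1)] (innovation g ℱ μ k) :=
  ((h.adapted (k + 1)).sub ((h.adapted k).mono (ℱ.mono k.le_succ))).sub
    (stronglyMeasurable_condExp.mono (ℱ.mono k.le_succ))

theorem innovation_abs_le (h : IsBoundedSupermartingale g ℱ μ L) (k : ℕ) :
    ∀ᵐ x ∂μ, |innovation g ℱ μ k x| ≤ 2 * L := by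
  filter_upwards [h.abs_condExp_increment_le k] with x hx
  have h1 := h.abs_increment_le k x
  have h2 := abs_sub (g (k + 1) x - g k x) ((μ[g (k + 1) - g k | ℱ k]) x)
  unfold innovation
  linarith

theorem integrable_innovation (h : IsBoundedSupermartingale g ℱ μ L) (k : ℕ) :
    Integrable (innovation g ℱ μ k) μ :=
  integrable_of_abs_le ((h.innovation_stronglyMeasurable k).mono (ℱ.le _)).aestronglyMeasurable
    (h.innovation_abs_le k)

theorem integrable_innovation_sq (h : IsBoundedSupermartingale g ℱ μ L) (k : ℕ) :
    Integrable (fun x => innovation g ℱ μ k x ^ 2) μ := by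
  refine integrable_of_abs_le (c := (2 * L) ^ 2)
    (((h.innovation_stronglyMeasurable k).mono (ℱ.le _)).pow 2).aestronglyMeasurable ?_
  filter_upwards [h.innovation_abs_le k] with x hx
  rw [abs_pow]
  exact pow_le_pow_left₀ (abs_nonneg _) hx 2

/-- Innovations are orthogonal to the past. -/
theorem integral_mul_innovation (h : IsBoundedSupermartingale g ℱ μ L) {k : ℕ} {Y : Ω → ℝ} {c : ℝ}
    (hY : StronglyMeasurable[ℱ k] Y) (hYc : ∀ᵐ x ∂μ, |Y x| ≤ c) :
    ∫ x, Y x * innovation g ℱ μ k x ∂μ = 0 := by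
  have h1 := integral_mul_condExp_of_bound (ℱ.le k) hY hYc (h.integrable_increment k)
  have hYm := (hY.mono (ℱ.le k)).aestronglyMeasurable (μ := μ)
  have e : (fun x => Y x * innovation g ℱ μ k x) = fun x =>
      Y x * (g (k + 1) - g k) x - Y x * (μ[g (k + 1) - g k | ℱ k]) x := by
    ext x; simp only [innovation, Pi.sub_apply]; ring
  rw [e, integral_sub ((h.integrable_increment k).bdd_mul hYm hYc)
    (integrable_condExp.bdd_mul hYm hYc), h1, sub_self]

/-- Pythagoras: the innovation is orthogonal to the predictable drift `c`, so dropping `c ^ 2` only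
decreases the energy. -/
theorem integral_innovation_sq_le (h : IsBoundedSupermartingale g ℱ μ L) (k : ℕ) :
    ∫ x, innovation g ℱ μ k x ^ 2 ∂μ ≤ ∫ x, (g (k + 1) x - g k x) ^ 2 ∂μ := by
  set c := μ[g (k + 1) - g k | ℱ k] with hc
  have hcm : StronglyMeasurable[ℱ k] c := stronglyMeasurable_condExp
  have h1 := h.integral_mul_innovation hcm (h.abs_condExp_increment_le k)
  have i1 : Integrable (fun x => c x * innovation g ℱ μ k x) μ :=
    (h.integrable_innovation k).bdd_mul (hcm.mono (ℱ.le k)).aestronglyMeasurable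
      (h.abs_condExp_increment_le k)
  have i3 : Integrable (fun x => c x ^ 2) μ := by
    refine integrable_of_abs_le (c := L ^ 2)
      ((hcm.mono (ℱ.le k)).pow 2).aestronglyMeasurable ?_
    filter_upwards [h.abs_condExp_increment_le k] with x hx
    rw [abs_pow]
    exact pow_le_pow_left₀ (abs_nonneg _) hx 2
  have e : ∀ x, (g (k + 1) x - g k x) ^ 2
      = (innovation g ℱ μ k x ^ 2 + 2 * (c x * innovation g ℱ μ k x)) + c x ^ 2 := by
    intro x; simp only [innovation, hc]; ring
  simp_rw [e]
  have i2 : Integrable (fun x => innovation g ℱ μ k x ^ 2 + 2 * (c x * innovation g ℱ μ k x)) μ :=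
    (h.integrable_innovation_sq k).add (i1.const_mul 2)
  rw [integral_add i2 i3, integral_add (h.integrable_innovation_sq k) (i1.const_mul 2), integral_const_mul, h1]
  have : 0 ≤ ∫ x, c x ^ 2 ∂μ := integral_nonneg fun x => sq_nonneg _
  linarith

theorem integrable_sq (h : IsBoundedSupermartingale g ℱ μ L) (k : ℕ) :
    Integrable (fun x => g k x ^ 2) μ := by
  refine integrable_of_abs_le (c := L ^ 2)
    (((h.adapted k).mono (ℱ.le _)).pow 2).aestronglyMeasurable (ae_of_all _ fun x => ?_)
  rw [abs_pow]
  exact pow_le_pow_left₀ (abs_nonneg _)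
    (abs_le.2 ⟨by linarith [h.nonneg k x, h.le k x], h.le k x⟩) 2

/-- The energy of an increment is controlled by that of a potential. -/
theorem integral_increment_sq_le (h : IsBoundedSupermartingale g ℱ μ L) (k : ℕ) :
    ∫ x, (g (k + 1) x - g k x) ^ 2 ∂μ ≤
      (∫ x, g (k + 1) x ^ 2 ∂μ - 2 * L * ∫ x, g (k + 1) x ∂μ)
        - (∫ x, g k x ^ 2 ∂μ - 2 * L * ∫ x, g k x ∂μ) := by
  have hY : StronglyMeasurable[ℱ k] fun x => L - g k x := stronglyMeasurable_const.sub (h.adapted k)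
  have hYc : ∀ᵐ x ∂μ, |L - g k x| ≤ L := ae_of_all _ fun x =>
    abs_le.2 ⟨by linarith [h.nonneg k x, h.le k x], by linarith [h.nonneg k x]⟩
  have h1 := integral_mul_condExp_of_bound (ℱ.le k) hY hYc (h.integrable_increment k)
  have h2 : ∫ x, (L - g k x) * (g (k + 1) - g k) x ∂μ ≤ 0 := by
    rw [← h1]
    refine integral_nonpos_of_ae ?_
    filter_upwards [h.condExp_le k] with x hx
    exact mul_nonpos_of_nonneg_of_nonpos (by linarith [h.le k x]) hx
  have i1 : Integrable (fun x => (L - g k x) * (g (k + 1) - g k) x) μ :=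
    (h.integrable_increment k).bdd_mul (hY.mono (ℱ.le k)).aestronglyMeasurable hYc
  -- With the potential `φ t = t² - 2Lt`, one has `(b - a)² = φ b - φ a + 2 (L - a) (b - a)`. The
  -- last term has nonpositive mean, because `L - g k ≥ 0` is known at time `k` and the drift is
  -- nonpositive.
  have e : ∀ x, (g (k + 1) x - g k x) ^ 2 = ((g (k + 1) x ^ 2 - 2 * L * g (k + 1) x)
      - (g k x ^ 2 - 2 * L * g k x)) + 2 * ((L - g k x) * (g (k + 1) - g k) x) := by
    intro x; simp only [Pi.sub_apply]; ring
  simp_rw [e]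
  have j1 := h.integrable_sq (k + 1)
  have j2 := h.integrable_sq k
  have j3 := (h.integrable (k + 1)).const_mul (2 * L)
  have j4 := (h.integrable k).const_mul (2 * L)
  have j5 : Integrable (fun x => g (k + 1) x ^ 2 - 2 * L * g (k + 1) x) μ := j1.sub j3
  have j6 : Integrable (fun x => g k x ^ 2 - 2 * L * g k x) μ := j2.sub j4
  have j7 : Integrable (fun x => (g (k + 1) x ^ 2 - 2 * L * g (k + 1) x)
      - (g k x ^ 2 - 2 * L * g k x)) μ := j5.sub j6
  rw [integral_add j7 (i1.const_mul 2), integral_sub j5 j6, integral_sub j1 j3, integral_sub j2 j4,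
    integral_const_mul, integral_const_mul, integral_const_mul]
  linarith

theorem innovationSum_stronglyAdapted (h : IsBoundedSupermartingale g ℱ μ L)
    (hε : IsMultiplier ε ℱ) : StronglyAdapted ℱ (innovationSum ε g ℱ μ) := by
  intro n
  refine Finset.stronglyMeasurable_fun_sum _ fun k hk => ?_
  have hk' : k + 1 ≤ n := Finset.mem_range.1 hk
  exact ((hε.adapted k).mono (ℱ.mono (by omega))).mul
    ((h.innovation_stronglyMeasurable k).mono (ℱ.mono hk'))

theorem innovationSum_abs_le (h : IsBoundedSupermartingale g ℱ μ L) (hε : IsMultiplier ε ℱ)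
    (n : ℕ) : ∀ᵐ x ∂μ, |innovationSum ε g ℱ μ n x| ≤ n * (2 * L) := by
  filter_upwards [ae_all_iff.2 h.innovation_abs_le] with x hx
  calc |innovationSum ε g ℱ μ n x| ≤ ∑ k ∈ Finset.range n, |ε k x * innovation g ℱ μ k x| :=
        Finset.abs_sum_le_sum_abs _ _
    _ ≤ ∑ k ∈ Finset.range n, 2 * L := by
        refine Finset.sum_le_sum fun k _ => ?_
        rw [abs_mul]
        nlinarith [hε.abs_le k x, hx k, abs_nonneg (ε k x), abs_nonneg (innovation g ℱ μ k x)]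
    _ = _ := by simp

theorem integrable_innovationSum (h : IsBoundedSupermartingale g ℱ μ L) (hε : IsMultiplier ε ℱ)
    (n : ℕ) : Integrable (innovationSum ε g ℱ μ n) μ :=
  integrable_of_abs_le ((h.innovationSum_stronglyAdapted hε n).mono (ℱ.le n)).aestronglyMeasurable
    (h.innovationSum_abs_le hε n)

theorem integrable_innovationSum_sq (h : IsBoundedSupermartingale g ℱ μ L)
    (hε : IsMultiplier ε ℱ) (n : ℕ) :
    Integrable (fun x => innovationSum ε g ℱ μ n x ^ 2) μ := by
  refine integrable_of_abs_le (c := (n * (2 * L)) ^ 2)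
    (((h.innovationSum_stronglyAdapted hε n).mono (ℱ.le n)).pow 2).aestronglyMeasurable ?_
  filter_upwards [h.innovationSum_abs_le hε n] with x hx
  rw [abs_pow]
  exact pow_le_pow_left₀ (abs_nonneg _) hx 2

theorem integrable_mul_innovation_sq (h : IsBoundedSupermartingale g ℱ μ L)
    (hε : IsMultiplier ε ℱ) (k : ℕ) :
    Integrable (fun x => (ε k x * innovation g ℱ μ k x) ^ 2) μ := by
  refine (h.integrable_innovation_sq k).mono'
    ((((hε.adapted k).mono (ℱ.le k)).mul
      ((h.innovation_stronglyMeasurable k).mono (ℱ.le _))).pow 2).aestronglyMeasurable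
    (ae_of_all _ fun x => ?_)
  have : ε k x ^ 2 ≤ 1 := (sq_le_one_iff_abs_le_one _).2 (hε.abs_le k x)
  rw [Real.norm_eq_abs, abs_of_nonneg (sq_nonneg _), mul_pow]
  exact mul_le_of_le_one_left (sq_nonneg _) this

theorem setIntegral_innovationSum_sq_succ (h : IsBoundedSupermartingale g ℱ μ L)
    (hε : IsMultiplier ε ℱ) (n : ℕ) {s : Set Ω} (hs : MeasurableSet[ℱ n] s) :
    ∫ x in s, innovationSum ε g ℱ μ (n + 1) x ^ 2 ∂μ =
      ∫ x in s, innovationSum ε g ℱ μ n x ^ 2 ∂μ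
        + ∫ x in s, (ε n x * innovation g ℱ μ n x) ^ 2 ∂μ := by
  -- The factor in front of the innovation in the cross term is known at time `n`, so orthogonality
  -- removes it, even after localizing to `s`.
  set Y : Ω → ℝ := s.indicator fun x => innovationSum ε g ℱ μ n x * ε n x with hYdef
  have hY : StronglyMeasurable[ℱ n] Y :=
    ((h.innovationSum_stronglyAdapted hε n).mul (hε.adapted n)).indicator hs
  have hYc : ∀ᵐ x ∂μ, |Y x| ≤ n * (2 * L) := by
    filter_upwards [h.innovationSum_abs_le hε n] with x hx
    by_cases hxs : x ∈ s
    · rw [hYdef, Set.indicator_of_mem hxs, abs_mul]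
      exact (mul_le_of_le_one_right (abs_nonneg _) (hε.abs_le n x)).trans hx
    · rw [hYdef, Set.indicator_of_notMem hxs, abs_zero]
      exact (abs_nonneg _).trans hx
  have hz : ∫ x in s, innovationSum ε g ℱ μ n x * ε n x * innovation g ℱ μ n x ∂μ = 0 := by
    rw [← h.integral_mul_innovation hY hYc, ← integral_indicator (ℱ.le n _ hs)]
    congr 1; ext x
    by_cases hxs : x ∈ s <;> simp [hYdef, hxs]
  have i1 : Integrable (fun x => innovationSum ε g ℱ μ n x * ε n x * innovation g ℱ μ n x) μ := by
    refine (h.integrable_innovation n).bdd_mul (c := n * (2 * L))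
      (((h.innovationSum_stronglyAdapted hε n).mul (hε.adapted n)).mono
        (ℱ.le n)).aestronglyMeasurable ?_
    filter_upwards [h.innovationSum_abs_le hε n] with x hx
    rw [Real.norm_eq_abs, abs_mul]
    exact (mul_le_of_le_one_right (abs_nonneg _) (hε.abs_le n x)).trans hx
  have e : ∀ x, innovationSum ε g ℱ μ (n + 1) x ^ 2 = (innovationSum ε g ℱ μ n x ^ 2
      + (ε n x * innovation g ℱ μ n x) ^ 2)
      + 2 * (innovationSum ε g ℱ μ n x * ε n x * innovation g ℱ μ n x) := by
    intro x; simp only [innovationSum, Finset.sum_range_succ]; ring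
  simp_rw [e]
  have i2 : Integrable (fun x => innovationSum ε g ℱ μ n x ^ 2
      + (ε n x * innovation g ℱ μ n x) ^ 2) μ :=
    (h.integrable_innovationSum_sq hε n).add (h.integrable_mul_innovation_sq hε n)
  rw [integral_add i2.integrableOn (i1.integrableOn.const_mul 2),
    integral_add (h.integrable_innovationSum_sq hε n).integrableOn
      (h.integrable_mul_innovation_sq hε n).integrableOn, integral_const_mul, hz]
  ring

theorem submartingale_innovationSum_sq (h : IsBoundedSupermartingale g ℱ μ L)
    (hε : IsMultiplier ε ℱ) :
    Submartingale (fun n x => innovationSum ε g ℱ μ n x ^ 2) ℱ μ := by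
  refine submartingale_of_setIntegral_le_succ
    (fun n => (h.innovationSum_stronglyAdapted hε n).pow 2) (h.integrable_innovationSum_sq hε)
    fun n s hs => ?_
  rw [h.setIntegral_innovationSum_sq_succ hε n hs]
  have : 0 ≤ ∫ x in s, (ε n x * innovation g ℱ μ n x) ^ 2 ∂μ := integral_nonneg fun x => sq_nonneg _
  linarith

/-- The one-step identity is in fact an equality, so this is a martingale; the submartingale form is
what the convergence theorem takes. -/
theorem submartingale_innovationSum (h : IsBoundedSupermartingale g ℱ μ L)
    (hε : IsMultiplier ε ℱ) : Submartingale (innovationSum ε g ℱ μ) ℱ μ := by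
  refine submartingale_of_setIntegral_le_succ (h.innovationSum_stronglyAdapted hε)
    (h.integrable_innovationSum hε) fun n s hs => ?_
  have hY : StronglyMeasurable[ℱ n] (s.indicator (ε n)) := (hε.adapted n).indicator hs
  have hYc : ∀ᵐ x ∂μ, |s.indicator (ε n) x| ≤ 1 := ae_of_all _ fun x => by
    by_cases hxs : x ∈ s <;> simp [hxs, hε.abs_le n x]
  have hz : ∫ x in s, ε n x * innovation g ℱ μ n x ∂μ = 0 := by
    rw [← h.integral_mul_innovation hY hYc, ← integral_indicator (ℱ.le n _ hs)]
    congr 1; ext x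
    by_cases hxs : x ∈ s <;> simp [hxs]
  have i1 : Integrable (fun x => ε n x * innovation g ℱ μ n x) μ :=
    (h.integrable_innovation n).bdd_mul ((hε.adapted n).mono (ℱ.le n)).aestronglyMeasurable
      (ae_of_all _ (hε.abs_le n))
  have e : ∀ x, innovationSum ε g ℱ μ (n + 1) x
      = innovationSum ε g ℱ μ n x + ε n x * innovation g ℱ μ n x := fun x => by
    simp only [innovationSum, Finset.sum_range_succ]
  simp_rw [e]
  rw [integral_add (h.integrable_innovationSum hε n).integrableOn i1.integrableOn, hz, add_zero]

theorem integral_innovationSum_sq_le_potential (h : IsBoundedSupermartingale g ℱ μ L)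
    (hε : IsMultiplier ε ℱ) (n : ℕ) :
    ∫ x, innovationSum ε g ℱ μ n x ^ 2 ∂μ ≤ (∫ x, g n x ^ 2 ∂μ - 2 * L * ∫ x, g n x ∂μ)
        - (∫ x, g 0 x ^ 2 ∂μ - 2 * L * ∫ x, g 0 x ∂μ) := by
  induction n with
  | zero => simp [innovationSum]
  | succ n ih =>
    have h1 := h.setIntegral_innovationSum_sq_succ hε n MeasurableSet.univ
    simp only [Measure.restrict_univ] at h1
    have h2 : ∫ x, (ε n x * innovation g ℱ μ n x) ^ 2 ∂μ ≤ ∫ x, innovation g ℱ μ n x ^ 2 ∂μ := by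
      refine integral_mono (h.integrable_mul_innovation_sq hε n) (h.integrable_innovation_sq n)
        fun x => ?_
      have : ε n x ^ 2 ≤ 1 := (sq_le_one_iff_abs_le_one _).2 (hε.abs_le n x)
      simp only [mul_pow]
      exact mul_le_of_le_one_left (sq_nonneg _) this
    linarith [h.integral_innovation_sq_le n, h.integral_increment_sq_le n]

/-- The energy estimate for transforms of the martingale part. -/
theorem integral_innovationSum_sq_le (h : IsBoundedSupermartingale g ℱ μ L)
    (hε : IsMultiplier ε ℱ) (n : ℕ) :
    ∫ x, innovationSum ε g ℱ μ n x ^ 2 ∂μ ≤ 2 * L * ∫ x, g 0 x ∂μ := by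
  have h1 := h.integral_innovationSum_sq_le_potential hε n
  -- Since `g² ≤ L g`, the terminal potential is nonpositive, and only the initial one survives.
  have h2 : ∫ x, g n x ^ 2 ∂μ ≤ L * ∫ x, g n x ∂μ := by
    rw [← integral_const_mul]
    refine integral_mono (h.integrable_sq n) ((h.integrable n).const_mul L) fun x => ?_
    simp only [sq]
    exact mul_le_mul_of_nonneg_right (h.le n x) (h.nonneg n x)
  have h3 : 0 ≤ L * ∫ x, g n x ∂μ := mul_nonneg h.bound_nonneg (integral_nonneg (h.nonneg n))
  have h4 : 0 ≤ ∫ x, g 0 x ^ 2 ∂μ := integral_nonneg fun x => sq_nonneg _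
  linarith

/-- The energy bound is uniform in `n`, and `|t| ≤ 1 + t²` turns it into the `L¹` bound required for
martingale convergence on a finite measure space. -/
theorem ae_tendsto_innovationSum (h : IsBoundedSupermartingale g ℱ μ L) (hε : IsMultiplier ε ℱ) :
    ∀ᵐ x ∂μ, ∃ c, Tendsto (fun n => innovationSum ε g ℱ μ n x) atTop (𝓝 c) := by
  refine (h.submartingale_innovationSum hε).exists_ae_tendsto_of_bdd
    (R := (μ.real Set.univ + 2 * L * ∫ x, g 0 x ∂μ).toNNReal) fun n => ?_
  rw [eLpNorm_one_eq_lintegral_enorm, ← ofReal_integral_norm_eq_lintegral_enorm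
    (h.integrable_innovationSum hε n)]
  refine ENNReal.ofReal_le_ofReal ?_
  calc ∫ x, ‖innovationSum ε g ℱ μ n x‖ ∂μ ≤ ∫ x, (1 + innovationSum ε g ℱ μ n x ^ 2) ∂μ := by
        refine integral_mono (h.integrable_innovationSum hε n).norm
          ((integrable_const 1).add (h.integrable_innovationSum_sq hε n)) fun x => ?_
        simp only [Real.norm_eq_abs]
        nlinarith [sq_abs (innovationSum ε g ℱ μ n x), sq_nonneg (|innovationSum ε g ℱ μ n x| - 1)]
    _ ≤ _ := by
        rw [integral_add (integrable_const 1) (h.integrable_innovationSum_sq hε n)]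
        have := h.integral_innovationSum_sq_le hε n
        simp
        linarith

/-- The total mass of the compensator is at most the initial mean. -/
theorem lintegral_compensator_le (h : IsBoundedSupermartingale g ℱ μ L) :
    ∫⁻ x, ∑' k, ENNReal.ofReal (-(μ[g (k + 1) - g k | ℱ k]) x) ∂μ
      ≤ ENNReal.ofReal (∫ x, g 0 x ∂μ) := by
  have hm : ∀ k, Integrable (fun x => -(μ[g (k + 1) - g k | ℱ k]) x) μ := fun k =>
    integrable_condExp.neg
  rw [lintegral_tsum fun k => (hm k).aestronglyMeasurable.aemeasurable.ennreal_ofReal]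
  refine ENNReal.tsum_le_of_sum_range_le fun n => ?_
  have hk : ∀ k, ∫⁻ x, ENNReal.ofReal (-(μ[g (k + 1) - g k | ℱ k]) x) ∂μ
      = ENNReal.ofReal (∫ x, g k x ∂μ - ∫ x, g (k + 1) x ∂μ) := by
    intro k
    rw [← ofReal_integral_eq_lintegral_ofReal (hm k), integral_neg, integral_condExp (ℱ.le k)]
    · congr 1
      have : ∫ x, (g (k + 1) - g k) x ∂μ = ∫ x, g (k + 1) x ∂μ - ∫ x, g k x ∂μ :=
        integral_sub (h.integrable _) (h.integrable _)
      rw [this]; ring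
    · filter_upwards [h.condExp_le k] with x hx
      simpa using hx
  simp_rw [hk]
  rw [← ENNReal.ofReal_sum_of_nonneg, Finset.sum_range_sub']
  · exact ENNReal.ofReal_le_ofReal (sub_le_self _ (integral_nonneg (h.nonneg n)))
  · intro k _
    have : ∫ x, (μ[g (k + 1) - g k | ℱ k]) x ∂μ ≤ 0 := integral_nonpos_of_ae (h.condExp_le k)
    rw [integral_condExp (ℱ.le k)] at this
    have e : ∫ x, (g (k + 1) - g k) x ∂μ = ∫ x, g (k + 1) x ∂μ - ∫ x, g k x ∂μ :=
      integral_sub (h.integrable _) (h.integrable _)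
    linarith

end IsBoundedSupermartingale

/-- The martingale transform `∑_{k<n} ε_k (f_{k+1} - f_k)`. -/
def transformSum (ε f : ℕ → Ω → ℝ) (n : ℕ) (x : Ω) : ℝ :=
  ∑ k ∈ Finset.range n, ε k x * (f (k + 1) x - f k x)

/-- Doob's maximal inequality over an infinite time horizon. -/
theorem measure_exists_lt_le {F : ℕ → Ω → ℝ} (hF : Submartingale F ℱ μ) (h0 : ∀ n x, 0 ≤ F n x)
    {K a : ℝ} (ha : 0 < a) (hK : ∀ n, ∫ x, F n x ∂μ ≤ K) :
    μ {x | ∃ n, a < F n x} ≤ ENNReal.ofReal (K / a) := by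
  have e : {x | ∃ n, a < F n x} = ⋃ n : ℕ, {x | ∃ k ≤ n, a < F k x} := by
    ext x; simp only [Set.mem_ofPred_eq, Set.mem_iUnion]
    exact ⟨fun ⟨n, hn⟩ => ⟨n, n, le_rfl, hn⟩, fun ⟨_, k, _, hk⟩ => ⟨k, hk⟩⟩
  have hmono : Monotone fun n : ℕ => {x | ∃ k ≤ n, a < F k x} :=
    fun n m hnm x ⟨k, hk, hx⟩ => ⟨k, hk.trans hnm, hx⟩
  rw [e, hmono.measure_iUnion]
  refine iSup_le fun n => ?_
  have hmax := maximal_ineq hF (fun n x => h0 n x) (ε := a.toNNReal) n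
  rw [Real.coe_toNNReal a ha.le] at hmax
  set A := {ω | a ≤ (Finset.range (n + 1)).sup'
    Finset.nonempty_range_add_one fun k => F k ω} with hA
  have hsub : {x | ∃ k ≤ n, a < F k x} ⊆ A := by
    rintro x ⟨k, hk, hx⟩
    exact (Finset.le_sup'_iff (f := fun k => F k x) _).2 ⟨k, Finset.mem_range.2 (Nat.lt_succ_of_le hk), hx.le⟩
  have hint : ∫ x in A, F n x ∂μ ≤ K :=
    (setIntegral_le_integral (hF.integrable n) (ae_of_all _ (h0 n))).trans (hK n)
  change ENNReal.ofReal a * _ ≤ _ at hmax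
  rw [ENNReal.ofReal_div_of_pos ha, ENNReal.le_div_iff_mul_le (by simp [ha]) (by simp), mul_comm]
  exact (mul_le_mul_right (measure_mono hsub) _).trans (hmax.trans (ENNReal.ofReal_le_ofReal hint))

namespace IsBoundedSupermartingale

/-- Doob decomposition: martingale part minus an increasing compensator, both multiplied by `ε`. -/
theorem transformSum_eq (ε g : ℕ → Ω → ℝ) (n : ℕ) (x : Ω) :
    transformSum ε g n x = innovationSum ε g ℱ μ n x
      - ∑ k ∈ Finset.range n, ε k x * -(μ[g (k + 1) - g k | ℱ k]) x := by
  rw [transformSum, innovationSum, ← Finset.sum_sub_distrib]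
  refine Finset.sum_congr rfl fun k _ => ?_
  unfold innovation; ring

theorem ae_tendsto_transformSum (h : IsBoundedSupermartingale g ℱ μ L) (hε : IsMultiplier ε ℱ) :
    ∀ᵐ x ∂μ, ∃ c, Tendsto (fun n => transformSum ε g n x) atTop (𝓝 c) := by
  have hm : AEMeasurable
      (fun x => ∑' k, ENNReal.ofReal (-(μ[g (k + 1) - g k | ℱ k]) x)) μ :=
    AEMeasurable.tsum fun k =>
      (integrable_condExp.neg).aestronglyMeasurable.aemeasurable.ennreal_ofReal
  filter_upwards [h.ae_tendsto_innovationSum hε, ae_all_iff.2 h.condExp_le,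
    ae_lt_top' hm (h.lintegral_compensator_le.trans_lt ENNReal.ofReal_lt_top).ne]
    with x ⟨c, hc⟩ hneg hfin
  have hs : Summable fun k => -(μ[g (k + 1) - g k | ℱ k]) x := by
    have := ENNReal.summable_toReal hfin.ne
    refine this.congr fun k => ENNReal.toReal_ofReal ?_
    simpa using hneg k
  have hs' : Summable fun k => ε k x * -(μ[g (k + 1) - g k | ℱ k]) x := by
    refine Summable.of_norm_bounded hs fun k => ?_
    have h0 : 0 ≤ -(μ[g (k + 1) - g k | ℱ k]) x := by simpa using hneg k
    rw [norm_mul, Real.norm_of_nonneg h0]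
    exact mul_le_of_le_one_left h0 (hε.abs_le k x)
  refine ⟨_, (hc.sub hs'.hasSum.tendsto_sum_nat).congr fun n => ?_⟩
  exact (transformSum_eq ε g n x).symm

/-- A value above `2L` forces the martingale part or the compensator above `L`. Doob's inequality
for squares costs `2L 𝔼 g₀ / L²`, Markov's inequality costs `𝔼 g₀ / L`, whence the constant `3`. -/
theorem measure_exists_transformSum_le (h : IsBoundedSupermartingale g ℱ μ L)
    (hε : IsMultiplier ε ℱ) (hL : 0 < L) :
    μ {x | ∃ n, 2 * L < |transformSum ε g n x|}
      ≤ 3 * ENNReal.ofReal ((∫ x, g 0 x ∂μ) / L) := by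
  set V : Ω → ℝ≥0∞ := fun x => ∑' k, ENNReal.ofReal (-(μ[g (k + 1) - g k | ℱ k]) x) with hV
  have hm : AEMeasurable V μ := AEMeasurable.tsum fun k =>
      (integrable_condExp.neg).aestronglyMeasurable.aemeasurable.ennreal_ofReal
  have h1 : μ {x | ∃ n, L ^ 2 < innovationSum ε g ℱ μ n x ^ 2}
      ≤ 2 * ENNReal.ofReal ((∫ x, g 0 x ∂μ) / L) := by
    refine (measure_exists_lt_le (h.submartingale_innovationSum_sq hε) (fun n x => sq_nonneg _)
      (by positivity) (h.integral_innovationSum_sq_le hε)).trans_eq ?_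
    rw [← ENNReal.ofReal_ofNat 2, ← ENNReal.ofReal_mul (by norm_num)]
    congr 1; field_simp
  have h2 : μ {x | ENNReal.ofReal L ≤ V x} ≤ ENNReal.ofReal ((∫ x, g 0 x ∂μ) / L) := by
    rw [ENNReal.ofReal_div_of_pos hL, ENNReal.le_div_iff_mul_le (by simp [hL]) (by simp), mul_comm]
    exact (mul_meas_ge_le_lintegral₀ hm _).trans h.lintegral_compensator_le
  have hsub : {x | ∃ n, 2 * L < |transformSum ε g n x|} ≤ᵐ[μ]
      ({x | ∃ n, L ^ 2 < innovationSum ε g ℱ μ n x ^ 2} ∪ {x | ENNReal.ofReal L ≤ V x} : Set Ω) := by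
    filter_upwards [ae_all_iff.2 h.condExp_le] with x hneg hx
    obtain ⟨n, hn⟩ := hx
    by_contra hcon
    have hcon' := not_or.1 hcon
    have c1 : innovationSum ε g ℱ μ n x ^ 2 ≤ L ^ 2 := not_lt.1 fun hh => hcon'.1 ⟨n, hh⟩
    have c2 : V x < ENNReal.ofReal L := not_le.1 hcon'.2
    have c3 : |innovationSum ε g ℱ μ n x| ≤ L := abs_le_of_sq_le_sq c1 hL.le
    have hneg' : ∀ k, 0 ≤ -(μ[g (k + 1) - g k | ℱ k]) x := fun k => by simpa using hneg k
    have c4 : ∑ k ∈ Finset.range n, -(μ[g (k + 1) - g k | ℱ k]) x ≤ L := by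
      have : ENNReal.ofReal (∑ k ∈ Finset.range n, -(μ[g (k + 1) - g k | ℱ k]) x)
          ≤ ENNReal.ofReal L := by
        rw [ENNReal.ofReal_sum_of_nonneg fun k _ => hneg' k]
        exact (ENNReal.sum_le_tsum _).trans c2.le
      exact (ENNReal.ofReal_le_ofReal_iff hL.le).1 this
    have c5 : |∑ k ∈ Finset.range n, ε k x * -(μ[g (k + 1) - g k | ℱ k]) x| ≤ L := by
      refine (Finset.abs_sum_le_sum_abs _ _).trans (le_trans (Finset.sum_le_sum fun k _ => ?_) c4)
      rw [abs_mul, abs_of_nonneg (hneg' k)]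
      exact mul_le_of_le_one_left (hneg' k) (hε.abs_le k x)
    rw [transformSum_eq (ℱ := ℱ) (μ := μ)] at hn
    have := abs_sub (innovationSum ε g ℱ μ n x)
      (∑ k ∈ Finset.range n, ε k x * -(μ[g (k + 1) - g k | ℱ k]) x)
    linarith
  calc _ ≤ _ := measure_mono_ae hsub
    _ ≤ _ := measure_union_le _ _
    _ ≤ _ := add_le_add h1 h2
    _ = _ := by ring

end IsBoundedSupermartingale

/-! ### Removing boundedness: truncating a nonnegative martingale at a height. -/

section NonnegMartingale

variable {f : ℕ → Ω → ℝ}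

theorem isBoundedSupermartingale_min (hf : Martingale f ℱ μ) (h0 : ∀ n x, 0 ≤ f n x)
    (hL : 0 ≤ L) : IsBoundedSupermartingale (fun n x => min (f n x) L) ℱ μ L := by
  have had : StronglyAdapted ℱ fun n x => min (f n x) L := fun n =>
    (continuous_id.min continuous_const).comp_stronglyMeasurable (hf.stronglyAdapted n)
  have hint : ∀ n, Integrable (fun x => min (f n x) L) μ := fun n =>
    (hf.integrable n).inf (integrable_const L)
  refine ⟨had, fun n x => le_min (h0 n x) hL, fun n x => min_le_right _ _, hL, fun n => ?_⟩
  have e1 : μ[(fun x => min (f (n + 1) x) L) | ℱ n] ≤ᵐ[μ] μ[f (n + 1) | ℱ n] :=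
    condExp_mono (hint _) (hf.integrable _) (ae_of_all _ fun x => min_le_left _ _)
  have e2 : μ[(fun x => min (f (n + 1) x) L) | ℱ n] ≤ᵐ[μ] μ[fun _ => L | ℱ n] :=
    condExp_mono (hint _) (integrable_const L) (ae_of_all _ fun x => min_le_right _ _)
  rw [condExp_const (ℱ.le n)] at e2
  have e3 := condExp_of_stronglyMeasurable (μ := μ) (ℱ.le n) (had n) (hint n)
  filter_upwards [e1, e2, condExp_sub (hint (n + 1)) (hint n) (ℱ n), hf.condExp_ae_eq n.le_succ]
    with x h1 h2 h3 h4
  rw [h3, Pi.sub_apply, e3, Pi.zero_apply, sub_nonpos]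
  exact le_min (h1.trans_eq h4) h2

theorem transformSum_min_eq {x : Ω} (hx : ∀ n, f n x ≤ L) (n : ℕ) :
    transformSum ε (fun n x => min (f n x) L) n x = transformSum ε f n x := by
  simp only [transformSum, min_eq_left (hx _)]

theorem integral_martingale_eq (hf : Martingale f ℱ μ) (n : ℕ) :
    ∫ x, f n x ∂μ = ∫ x, f 0 x ∂μ := by
  have := hf.setIntegral_eq n.zero_le MeasurableSet.univ
  simpa using this.symm

theorem measure_exists_lt_martingale_le (hf : Martingale f ℱ μ) (h0 : ∀ n x, 0 ≤ f n x)
    (hL : 0 < L) : μ {x | ∃ n, L < f n x} ≤ ENNReal.ofReal ((∫ x, f 0 x ∂μ) / L) :=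
  measure_exists_lt_le hf.submartingale h0 hL fun n => (integral_martingale_eq hf n).le

/-- **Burkholder's weak-type inequality** for transforms of a nonnegative martingale. -/
theorem measure_exists_transformSum_le (hf : Martingale f ℱ μ) (h0 : ∀ n x, 0 ≤ f n x)
    (hε : IsMultiplier ε ℱ) (hL : 0 < L) :
    μ {x | ∃ n, 2 * L < |transformSum ε f n x|}
      ≤ 4 * ENNReal.ofReal ((∫ x, f 0 x ∂μ) / L) := by
  have hg := isBoundedSupermartingale_min hf h0 hL.le
  have h1 := hg.measure_exists_transformSum_le hε hL
  have h2 : ∫ x, min (f 0 x) L ∂μ ≤ ∫ x, f 0 x ∂μ :=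
    integral_mono (hg.integrable 0) (hf.integrable 0) fun x => min_le_left _ _
  -- Off the event that `f` exceeds `L`, truncation changes nothing; that event contributes the
  -- remaining unit of the constant `4 = 1 + 3`.
  have hsub : {x | ∃ n, 2 * L < |transformSum ε f n x|} ⊆ {x | ∃ n, L < f n x} ∪
      {x | ∃ n, 2 * L < |transformSum ε (fun n x => min (f n x) L) n x|} := by
    rintro x ⟨n, hn⟩
    by_cases hx : ∃ n, L < f n x
    · exact Or.inl hx
    · push Not at hx
      exact Or.inr ⟨n, by rwa [transformSum_min_eq hx]⟩
  calc _ ≤ _ := measure_mono hsub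
    _ ≤ _ := measure_union_le _ _
    _ ≤ _ := add_le_add (measure_exists_lt_martingale_le hf h0 hL)
      (h1.trans (mul_le_mul_right (ENNReal.ofReal_le_ofReal
        (div_le_div_of_nonneg_right h2 hL.le)) 3))
    _ = _ := by ring

/-- Transforms of a nonnegative martingale converge almost everywhere. -/
theorem ae_tendsto_transformSum (hf : Martingale f ℱ μ) (h0 : ∀ n x, 0 ≤ f n x)
    (hε : IsMultiplier ε ℱ) :
    ∀ᵐ x ∂μ, ∃ c, Tendsto (fun n => transformSum ε f n x) atTop (𝓝 c) := by
  have hconv : ∀ᵐ x ∂μ, ∃ c, Tendsto (fun n => f n x) atTop (𝓝 c) := by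
    refine hf.submartingale.exists_ae_tendsto_of_bdd (R := (∫ x, f 0 x ∂μ).toNNReal) fun n => ?_
    rw [eLpNorm_one_eq_lintegral_enorm, ← ofReal_integral_norm_eq_lintegral_enorm (hf.integrable n)]
    refine ENNReal.ofReal_le_ofReal ?_
    simp only [Real.norm_of_nonneg (h0 n _)]
    exact (integral_martingale_eq hf n).le
  -- Almost every trajectory of `f` converges, hence is bounded by some integer `N`, so countably
  -- many truncation heights suffice.
  have htr : ∀ᵐ x ∂μ, ∀ N : ℕ, ∃ c,
      Tendsto (fun n => transformSum ε (fun n x => min (f n x) (N : ℝ)) n x) atTop (𝓝 c) :=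
    ae_all_iff.2 fun N =>
      (isBoundedSupermartingale_min hf h0 (Nat.cast_nonneg N)).ae_tendsto_transformSum hε
  filter_upwards [hconv, htr] with x ⟨c, hc⟩ hx
  obtain ⟨B, hB⟩ := hc.bddAbove_range
  obtain ⟨N, hN⟩ := exists_nat_ge B
  obtain ⟨d, hd⟩ := hx N
  refine ⟨d, hd.congr fun n => transformSum_min_eq (fun k => ?_) n⟩
  exact (hB ⟨k, rfl⟩).trans hN

end NonnegMartingale

end MartingaleTransform

/-! ### Cells, averages, and the weak-type inequality on an atom. -/

namespace PartitionFiltration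

variable {Ω : Type*} [MeasurableSpace Ω] {μ : Measure Ω} (𝒬 : PartitionFiltration Ω μ)

section Cells

variable {𝒬}

theorem cell_eq_of_mem {n : ℤ} {x : Ω} {Q : Set Ω} (hQ : Q ∈ 𝒬.part n) (hx : x ∈ Q) :
    𝒬.cell n x = Q := by
  have : {R | R ∈ 𝒬.part n ∧ x ∈ R} = {Q} := by
    ext R
    refine ⟨fun hR => ?_, fun hR => ?_⟩
    · exact ((𝒬.isPartition n).2 x).unique ⟨hR.1, hR.2⟩ ⟨hQ, hx⟩
    · rw [Set.mem_singleton_iff] at hR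
      subst hR
      exact ⟨hQ, hx⟩
  rw [cell, this, Set.sUnion_singleton]

variable (𝒬)

theorem cell_mem_part (n : ℤ) (x : Ω) : 𝒬.cell n x ∈ 𝒬.part n := by
  obtain ⟨Q, ⟨hQ, hx⟩, -⟩ := (𝒬.isPartition n).2 x
  rwa [cell_eq_of_mem hQ hx]

theorem mem_cell (n : ℤ) (x : Ω) : x ∈ 𝒬.cell n x := by
  obtain ⟨Q, ⟨hQ, hx⟩, -⟩ := (𝒬.isPartition n).2 x
  rwa [cell_eq_of_mem hQ hx]

theorem cell_mem_atoms (n : ℤ) (x : Ω) : 𝒬.cell n x ∈ 𝒬.atoms :=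
  Set.mem_iUnion.2 ⟨n, 𝒬.cell_mem_part n x⟩

variable {𝒬}

theorem mem_cell_iff {n : ℤ} {x y : Ω} : y ∈ 𝒬.cell n x ↔ 𝒬.cell n y = 𝒬.cell n x :=
  ⟨fun h => cell_eq_of_mem (𝒬.cell_mem_part n x) h, fun h => h ▸ 𝒬.mem_cell n y⟩

theorem cell_succ_subset (n : ℤ) (x : Ω) : 𝒬.cell (n + 1) x ⊆ 𝒬.cell n x := by
  obtain ⟨𝒞, h𝒞, he⟩ := 𝒬.refines n _ (𝒬.cell_mem_part n x)
  have hx := 𝒬.mem_cell n x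
  rw [he] at hx
  obtain ⟨C, hC, hxC⟩ := hx
  rw [cell_eq_of_mem (h𝒞 hC) hxC, he]
  exact Set.subset_sUnion_of_mem hC

theorem cell_antitone (x : Ω) : Antitone fun n => 𝒬.cell n x :=
  antitone_int_of_succ_le fun n => cell_succ_subset n x

theorem cell_eq_of_le {m n : ℤ} (hmn : m ≤ n) {x y : Ω} (h : 𝒬.cell n x = 𝒬.cell n y) :
    𝒬.cell m x = 𝒬.cell m y :=
  mem_cell_iff.1 (cell_antitone y hmn (mem_cell_iff.2 h))

theorem cell_subset_of_mem {m n : ℤ} (hmn : m ≤ n) {P : Set Ω} (hP : P ∈ 𝒬.part m) {x : Ω}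
    (hx : x ∈ P) : 𝒬.cell n x ⊆ P :=
  (cell_antitone x hmn).trans_eq (cell_eq_of_mem hP hx)

theorem exists_part {P : Set Ω} (hP : P ∈ 𝒬.atoms) : ∃ n, P ∈ 𝒬.part n := Set.mem_iUnion.1 hP

theorem nonempty_of_mem_part {n : ℤ} {P : Set Ω} (hP : P ∈ 𝒬.part n) : P.Nonempty :=
  nonempty_of_measure_ne_zero (𝒬.measure_pos n P hP).ne'

theorem nonempty_of_mem_atoms {P : Set Ω} (hP : P ∈ 𝒬.atoms) : P.Nonempty :=
  let ⟨_, hn⟩ := exists_part hP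
  nonempty_of_mem_part hn

theorem measurableSet_of_mem_atoms {P : Set Ω} (hP : P ∈ 𝒬.atoms) : MeasurableSet P :=
  let ⟨n, hn⟩ := exists_part hP
  𝒬.measurableSet n P hn

theorem measure_pos_of_mem_atoms {P : Set Ω} (hP : P ∈ 𝒬.atoms) : 0 < μ P :=
  let ⟨n, hn⟩ := exists_part hP
  𝒬.measure_pos n P hn

theorem measure_lt_top_of_mem_atoms {P : Set Ω} (hP : P ∈ 𝒬.atoms) : μ P < ∞ :=
  let ⟨n, hn⟩ := exists_part hP
  𝒬.measure_lt_top n P hn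

theorem measureReal_pos {P : Set Ω} (hP : P ∈ 𝒬.atoms) : 0 < μ.real P :=
  ENNReal.toReal_pos (measure_pos_of_mem_atoms hP).ne' (measure_lt_top_of_mem_atoms hP).ne

/-- Intersecting atoms are nested. -/
theorem subset_or_subset_of_mem {P R : Set Ω} (hP : P ∈ 𝒬.atoms) (hR : R ∈ 𝒬.atoms) {x : Ω}
    (hxP : x ∈ P) (hxR : x ∈ R) : P ⊆ R ∨ R ⊆ P := by
  obtain ⟨p, hp⟩ := exists_part hP
  obtain ⟨r, hr⟩ := exists_part hR
  rw [← cell_eq_of_mem hp hxP, ← cell_eq_of_mem hr hxR]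
  rcases le_total p r with h | h
  · exact Or.inr (cell_antitone x h)
  · exact Or.inl (cell_antitone x h)

/-- An atom strictly inside another one occurs only at strictly later levels. -/
theorem level_lt_of_ssubset {P R : Set Ω} {p r : ℤ} (hp : P ∈ 𝒬.part p) (hr : R ∈ 𝒬.part r)
    (h : R ⊂ P) : p < r := by
  by_contra hle
  obtain ⟨x, hx⟩ := nonempty_of_mem_part hr
  refine h.not_subset ?_
  rw [← cell_eq_of_mem hp (h.subset hx), ← cell_eq_of_mem hr hx]
  exact cell_antitone x (not_lt.1 hle)

variable (𝒬)

/-- Disjoint measurable sets of positive measure are countable in number in a `σ`-finite space.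
Hence arbitrary unions of cells of one level are measurable. -/
theorem part_countable [SigmaFinite μ] (n : ℤ) : (𝒬.part n).Countable := by
  have h := Measure.countable_meas_pos_of_disjoint_iUnion (μ := μ)
    (As := fun Q : 𝒬.part n => (Q : Set Ω)) (fun Q => 𝒬.measurableSet n Q Q.2)
    (fun Q R hQR => (𝒬.isPartition n).pairwiseDisjoint Q.2 R.2 (Subtype.coe_injective.ne hQR))
  have : {Q : 𝒬.part n | 0 < μ (Q : Set Ω)} = Set.univ :=
    Set.eq_univ_of_forall fun Q => 𝒬.measure_pos n Q Q.2
  rw [this, Set.countable_univ_iff] at h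
  exact h

theorem preimage_cell_eq_iUnion (n : ℤ) (T : Set (Set Ω)) :
    𝒬.cell n ⁻¹' T = ⋃ Q : {Q : Set Ω // Q ∈ 𝒬.part n ∧ Q ∈ T}, (Q : Set Ω) := by
  ext x
  simp only [Set.mem_preimage, Set.mem_iUnion]
  refine ⟨fun h => ⟨⟨_, 𝒬.cell_mem_part n x, h⟩, 𝒬.mem_cell n x⟩, ?_⟩
  rintro ⟨⟨Q, hQ, hT⟩, hx⟩
  rwa [cell_eq_of_mem hQ hx]

theorem countable_subtype [SigmaFinite μ] (n : ℤ) (T : Set (Set Ω)) :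
    Countable {Q : Set Ω // Q ∈ 𝒬.part n ∧ Q ∈ T} :=
  ((𝒬.part_countable n).mono fun _ h => h.1 : {Q : Set Ω | Q ∈ 𝒬.part n ∧ Q ∈ T}.Countable).to_subtype

theorem disjoint_subtype (n : ℤ) (T : Set (Set Ω)) :
    Pairwise (Function.onFun Disjoint
      fun Q : {Q : Set Ω // Q ∈ 𝒬.part n ∧ Q ∈ T} => (Q : Set Ω)) :=
  fun Q R hQR => (𝒬.isPartition n).pairwiseDisjoint Q.2.1 R.2.1 (Subtype.coe_injective.ne hQR)

theorem measurableSet_subtype (n : ℤ) (T : Set (Set Ω))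
    (Q : {Q : Set Ω // Q ∈ 𝒬.part n ∧ Q ∈ T}) : MeasurableSet (Q : Set Ω) :=
  𝒬.measurableSet n Q Q.2.1

theorem measurableSet_preimage_cell [SigmaFinite μ] (n : ℤ) (T : Set (Set Ω)) :
    MeasurableSet (𝒬.cell n ⁻¹' T) := by
  have := 𝒬.countable_subtype n T
  rw [preimage_cell_eq_iUnion]
  exact MeasurableSet.iUnion fun Q => 𝒬.measurableSet n Q Q.2.1

/-- The filtration of the partitions from level `p` on. -/
def filtrationFrom [SigmaFinite μ] (p : ℤ) : Filtration ℕ ‹MeasurableSpace Ω› where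
  seq n := MeasurableSpace.comap (𝒬.cell (p + n)) ⊤
  mono' := by
    rintro i j hij _ ⟨T, -, rfl⟩
    -- A union of coarse cells is the union of all fine cells of its points.
    refine ⟨𝒬.cell (p + j) '' (𝒬.cell (p + i) ⁻¹' T), trivial, ?_⟩
    ext x
    simp only [Set.mem_preimage, Set.mem_image]
    refine ⟨fun ⟨y, hy, hxy⟩ => ?_, fun h => ⟨x, h, rfl⟩⟩
    rwa [← cell_eq_of_le (m := p + i) (n := p + j) (by omega) hxy]
  le' := by
    rintro n _ ⟨T, -, rfl⟩
    exact 𝒬.measurableSet_preimage_cell _ T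

theorem stronglyMeasurable_comp_cell [SigmaFinite μ] (p : ℤ) (n : ℕ) (φ : Set Ω → ℝ) :
    StronglyMeasurable[𝒬.filtrationFrom p n] fun x => φ (𝒬.cell (p + n) x) :=
  Measurable.stronglyMeasurable fun s _ => ⟨φ ⁻¹' s, trivial, rfl⟩

end Cells

section Averages

variable {E : Type*} [NormedAddCommGroup E] [NormedSpace ℝ E]

/-- The conditional average of `f` at level `n`. -/
def average (f : Ω → E) (n : ℤ) (x : Ω) : E := ⨍ y in 𝒬.cell n x, f y ∂μ

variable {𝒬}

theorem average_eq_of_mem {f : Ω → E} {n : ℤ} {Q : Set Ω} (hQ : Q ∈ 𝒬.part n) {x : Ω}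
    (hx : x ∈ Q) : 𝒬.average f n x = ⨍ y in Q, f y ∂μ := by
  rw [average, cell_eq_of_mem hQ hx]

theorem norm_average_le (f : Ω → E) (n : ℤ) (x : Ω) :
    ‖𝒬.average f n x‖ ≤ 𝒬.average (fun y => ‖f y‖) n x := by
  simp only [average, setAverage_eq, norm_smul, smul_eq_mul, norm_inv,
    Real.norm_of_nonneg measureReal_nonneg]
  exact mul_le_mul_of_nonneg_left (norm_integral_le_integral_norm _)
    (inv_nonneg.2 measureReal_nonneg)

theorem average_nonneg {f : Ω → ℝ} (hf : ∀ x, 0 ≤ f x) (n : ℤ) (x : Ω) :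
    0 ≤ 𝒬.average f n x := by
  simp only [average, setAverage_eq, smul_eq_mul]
  exact mul_nonneg (inv_nonneg.2 measureReal_nonneg) (integral_nonneg hf)

theorem setIntegral_average_part [CompleteSpace E] (f : Ω → E) {n : ℤ} {Q : Set Ω}
    (hQ : Q ∈ 𝒬.part n) : ∫ x in Q, 𝒬.average f n x ∂μ = ∫ x in Q, f x ∂μ := by
  rw [setIntegral_congr_fun (𝒬.measurableSet n Q hQ) fun x hx => average_eq_of_mem hQ hx,
    setIntegral_const, setAverage_eq, smul_smul, mul_inv_cancel₀, one_smul]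
  exact (measureReal_pos (Set.mem_iUnion.2 ⟨n, hQ⟩)).ne'

theorem integrable_average [SigmaFinite μ] {f : Ω → ℝ} (hf : Integrable f μ) (n : ℤ) :
    Integrable (𝒬.average f n) μ := by
  have hm : Measurable (𝒬.average f n) := fun s _ =>
    𝒬.measurableSet_preimage_cell n {Q | ⨍ y in Q, f y ∂μ ∈ s}
  refine ⟨hm.aestronglyMeasurable, ?_⟩
  refine lt_of_le_of_lt ?_ hf.2
  have := 𝒬.countable_subtype n Set.univ
  have hu : (Set.univ : Set Ω) = ⋃ Q : {Q : Set Ω // Q ∈ 𝒬.part n ∧ Q ∈ Set.univ}, (Q : Set Ω) := by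
    rw [← 𝒬.preimage_cell_eq_iUnion n Set.univ, Set.preimage_univ]
  rw [← setLIntegral_univ, ← setLIntegral_univ fun x => ‖f x‖ₑ, hu,
    lintegral_iUnion (𝒬.measurableSet_subtype n _) (𝒬.disjoint_subtype n _),
    lintegral_iUnion (𝒬.measurableSet_subtype n _) (𝒬.disjoint_subtype n _)]
  refine ENNReal.tsum_le_tsum fun ⟨Q, hQ, _⟩ => ?_
  have hpos := measureReal_pos (Set.mem_iUnion.2 ⟨n, hQ⟩ : Q ∈ 𝒬.atoms)
  rw [setLIntegral_congr_fun (𝒬.measurableSet n Q hQ)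
    fun x hx => by rw [average_eq_of_mem hQ hx], setLIntegral_const, setAverage_eq, enorm_smul,
    mul_right_comm]
  have e : ‖(μ.real Q)⁻¹‖ₑ * μ Q = 1 := by
    rw [Real.enorm_of_nonneg (inv_nonneg.2 hpos.le), ENNReal.ofReal_inv_of_pos hpos,
      ofReal_measureReal (𝒬.measure_lt_top n Q hQ).ne]
    exact ENNReal.inv_mul_cancel (𝒬.measure_pos n Q hQ).ne' (𝒬.measure_lt_top n Q hQ).ne
  rw [e, one_mul]
  exact enorm_integral_le_lintegral_enorm _

theorem setIntegral_average_preimage [SigmaFinite μ] {f : Ω → ℝ} (hf : Integrable f μ) (n : ℤ)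
    (T : Set (Set Ω)) :
    ∫ x in 𝒬.cell n ⁻¹' T, 𝒬.average f n x ∂μ = ∫ x in 𝒬.cell n ⁻¹' T, f x ∂μ := by
  have := 𝒬.countable_subtype n T
  rw [preimage_cell_eq_iUnion,
    integral_iUnion (𝒬.measurableSet_subtype n _) (𝒬.disjoint_subtype n _)
      (integrable_average hf n).integrableOn,
    integral_iUnion (𝒬.measurableSet_subtype n _) (𝒬.disjoint_subtype n _) hf.integrableOn]
  exact tsum_congr fun Q => setIntegral_average_part f Q.2.1

/-- The conditional averages on an atom form a martingale. -/
theorem martingale_average [SigmaFinite μ] {f : Ω → ℝ} (hf : Integrable f μ) {p : ℤ} {P : Set Ω}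
    (hP : P ∈ 𝒬.part p) :
    Martingale (fun n : ℕ => 𝒬.average f (p + n)) (𝒬.filtrationFrom p) (μ.restrict P) := by
  have : IsFiniteMeasure (μ.restrict P) := ⟨by simpa using 𝒬.measure_lt_top p P hP⟩
  have had : StronglyAdapted (𝒬.filtrationFrom p) fun n : ℕ => 𝒬.average f (p + n) := fun n =>
    𝒬.stronglyMeasurable_comp_cell p n fun Q => ⨍ y in Q, f y ∂μ
  have key : ∀ n : ℕ,
      𝒬.average f (p + n) =ᵐ[μ.restrict P] (μ.restrict P)[f | 𝒬.filtrationFrom p n] := by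
    intro n
    refine ae_eq_condExp_of_forall_setIntegral_eq ((𝒬.filtrationFrom p).le n) hf.restrict
      (fun s _ _ => (integrable_average hf _).restrict.integrableOn) ?_
      (had n).aestronglyMeasurable
    rintro s ⟨T, -, rfl⟩ -
    -- From level `p` on, each cell lies inside `P` or misses it, so intersecting with `P` leaves a
    -- union of cells.
    have hPT : 𝒬.cell (p + n) ⁻¹' T ∩ P = 𝒬.cell (p + n) ⁻¹' (T ∩ {Q | Q ⊆ P}) := by
      ext x
      refine and_congr_right fun _ => ⟨fun hx => ?_, fun hx => hx (𝒬.mem_cell _ x)⟩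
      exact cell_subset_of_mem (by omega) hP hx
    rw [Measure.restrict_restrict (𝒬.measurableSet_preimage_cell _ T), hPT]
    exact setIntegral_average_preimage hf _ _
  refine ⟨had, fun i j hij => ?_⟩
  exact (condExp_congr_ae (key j)).trans
    (((𝒬.filtrationFrom p).condExp_condExp f hij).trans (key i).symm)

end Averages

section Transform

variable {𝒬}

/-- The multiplier of the increment from level `p + n` to the next depends only on the cell at level
`p + n`: it is predictable. -/
theorem isMultiplier_comp_cell [SigmaFinite μ] {η : Set Ω → ℝ} (hη : ∀ Q ∈ 𝒬.atoms, |η Q| ≤ 1)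
    (p : ℤ) : MartingaleTransform.IsMultiplier (fun (n : ℕ) x => η (𝒬.cell (p + n) x))
      (𝒬.filtrationFrom p) :=
  ⟨fun n => 𝒬.stronglyMeasurable_comp_cell p n η, fun _ _ => hη _ (𝒬.cell_mem_atoms _ _)⟩

variable {𝕜 : Type*} [RCLike 𝕜]

variable (𝒬) in
/-- The `m`-th increment of the transform, seen along the cells of a point. -/
def increment (ε : Set Ω → 𝕜) (f : Ω → 𝕜) (m : ℤ) (x : Ω) : 𝕜 :=
  ε (𝒬.cell m x) * (𝒬.average f (m + 1) x - 𝒬.average f m x)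

variable (𝒬) in
/-- The sum of `n` increments from level `p` on. -/
def partialTransform (ε : Set Ω → 𝕜) (f : Ω → 𝕜) (p : ℤ) (n : ℕ) (x : Ω) : 𝕜 :=
  ∑ k ∈ Finset.range n, 𝒬.increment ε f (p + k) x

theorem partialTransform_eq_transformSum (η : Set Ω → ℝ) (f : Ω → ℝ) (p : ℤ) (n : ℕ) (x : Ω) :
    𝒬.partialTransform η f p n x = MartingaleTransform.transformSum
      (fun (n : ℕ) x => η (𝒬.cell (p + n) x)) (fun n : ℕ => 𝒬.average f (p + n)) n x := by
  simp only [partialTransform, MartingaleTransform.transformSum, increment, Nat.cast_succ,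
    add_assoc]

theorem average_sub {f g : Ω → ℝ} (hf : Integrable f μ) (hg : Integrable g μ) (n : ℤ) (x : Ω) :
    𝒬.average (fun y => f y - g y) n x = 𝒬.average f n x - 𝒬.average g n x := by
  simp only [average, setAverage_eq, integral_sub hf.restrict hg.restrict, smul_sub]

theorem re_average {f : Ω → 𝕜} (hf : Integrable f μ) (n : ℤ) (x : Ω) :
    RCLike.re (𝒬.average f n x) = 𝒬.average (fun y => RCLike.re (f y)) n x := by
  simp only [average, setAverage_eq, RCLike.smul_re, smul_eq_mul, integral_re hf.restrict]

theorem im_average {f : Ω → 𝕜} (hf : Integrable f μ) (n : ℤ) (x : Ω) :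
    RCLike.im (𝒬.average f n x) = 𝒬.average (fun y => RCLike.im (f y)) n x := by
  simp only [average, setAverage_eq, RCLike.smul_im, smul_eq_mul, integral_im hf.restrict]

theorem re_partialTransform (ε : Set Ω → 𝕜) {f : Ω → 𝕜} (hf : Integrable f μ) (p : ℤ) (n : ℕ)
    (x : Ω) : RCLike.re (𝒬.partialTransform ε f p n x) =
      𝒬.partialTransform (fun Q => RCLike.re (ε Q)) (fun y => RCLike.re (f y)) p n x
      - 𝒬.partialTransform (fun Q => RCLike.im (ε Q)) (fun y => RCLike.im (f y)) p n x := by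
  simp only [partialTransform, increment, map_sum, RCLike.mul_re, map_sub, re_average hf,
    im_average hf, Finset.sum_sub_distrib]

theorem im_partialTransform (ε : Set Ω → 𝕜) {f : Ω → 𝕜} (hf : Integrable f μ) (p : ℤ) (n : ℕ)
    (x : Ω) : RCLike.im (𝒬.partialTransform ε f p n x) =
      𝒬.partialTransform (fun Q => RCLike.re (ε Q)) (fun y => RCLike.im (f y)) p n x
      + 𝒬.partialTransform (fun Q => RCLike.im (ε Q)) (fun y => RCLike.re (f y)) p n x := by
  simp only [partialTransform, increment, map_sum, RCLike.mul_im, map_sub, re_average hf,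
    im_average hf, Finset.sum_add_distrib]

theorem partialTransform_posPart_sub (η : Set Ω → ℝ) {f : Ω → ℝ} (hf : Integrable f μ) (p : ℤ)
    (n : ℕ) (x : Ω) : 𝒬.partialTransform η f p n x =
      𝒬.partialTransform η (fun y => max (f y) 0) p n x
      - 𝒬.partialTransform η (fun y => max (-f y) 0) p n x := by
  have e : f = fun y => max (f y) 0 - max (-f y) 0 := by
    ext y; exact (max_zero_sub_max_neg_zero_eq_self (f y)).symm
  conv_lhs => rw [e]
  simp only [partialTransform, increment, average_sub hf.pos_part hf.neg_part,
    ← Finset.sum_sub_distrib]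
  exact Finset.sum_congr rfl fun k _ => by ring

variable {p : ℤ} {P : Set Ω}

theorem isFiniteMeasure_restrict (hP : P ∈ 𝒬.part p) : IsFiniteMeasure (μ.restrict P) :=
  ⟨by simpa using 𝒬.measure_lt_top p P hP⟩

theorem setIntegral_average_zero (f : Ω → ℝ) (hP : P ∈ 𝒬.part p) :
    ∫ x in P, 𝒬.average f (p + (0 : ℕ)) x ∂μ = ∫ x in P, f x ∂μ := by
  rw [Nat.cast_zero, add_zero]
  exact setIntegral_average_part f hP

variable [SigmaFinite μ]

theorem ae_tendsto_partialTransform_of_nonneg (hP : P ∈ 𝒬.part p) {η : Set Ω → ℝ}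
    (hη : ∀ Q ∈ 𝒬.atoms, |η Q| ≤ 1) {f : Ω → ℝ} (hf : Integrable f μ) (h0 : ∀ x, 0 ≤ f x) :
    ∀ᵐ x ∂μ.restrict P, ∃ c, Tendsto (fun n => 𝒬.partialTransform η f p n x) atTop (𝓝 c) := by
  have := isFiniteMeasure_restrict hP
  simp only [partialTransform_eq_transformSum]
  exact MartingaleTransform.ae_tendsto_transformSum (martingale_average hf hP)
    (fun n x => average_nonneg h0 _ x) (isMultiplier_comp_cell hη p)

theorem measure_partialTransform_le_of_nonneg (hP : P ∈ 𝒬.part p) {η : Set Ω → ℝ}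
    (hη : ∀ Q ∈ 𝒬.atoms, |η Q| ≤ 1) {f : Ω → ℝ} (hf : Integrable f μ) (h0 : ∀ x, 0 ≤ f x)
    {L : ℝ} (hL : 0 < L) : μ.restrict P {x | ∃ n, 2 * L < |𝒬.partialTransform η f p n x|}
      ≤ 4 * ENNReal.ofReal ((∫ x in P, f x ∂μ) / L) := by
  have := isFiniteMeasure_restrict hP
  simp only [partialTransform_eq_transformSum]
  rw [← setIntegral_average_zero f hP]
  exact MartingaleTransform.measure_exists_transformSum_le (martingale_average hf hP)
    (fun n x => average_nonneg h0 _ x) (isMultiplier_comp_cell hη p) hL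

theorem ae_tendsto_partialTransform_real (hP : P ∈ 𝒬.part p) {η : Set Ω → ℝ}
    (hη : ∀ Q ∈ 𝒬.atoms, |η Q| ≤ 1) {f : Ω → ℝ} (hf : Integrable f μ) :
    ∀ᵐ x ∂μ.restrict P, ∃ c, Tendsto (fun n => 𝒬.partialTransform η f p n x) atTop (𝓝 c) := by
  filter_upwards [
    ae_tendsto_partialTransform_of_nonneg hP hη hf.pos_part fun x => le_max_right _ _,
    ae_tendsto_partialTransform_of_nonneg hP hη hf.neg_part fun x => le_max_right _ _]
    with x ⟨c, hc⟩ ⟨d, hd⟩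
  exact ⟨c - d, (hc.sub hd).congr fun n => (partialTransform_posPart_sub η hf p n x).symm⟩

theorem measure_partialTransform_le_real (hP : P ∈ 𝒬.part p) {η : Set Ω → ℝ}
    (hη : ∀ Q ∈ 𝒬.atoms, |η Q| ≤ 1) {f g : Ω → ℝ} (hf : Integrable f μ) (hg : Integrable g μ)
    (hfg : ∀ x, |f x| ≤ g x) {L : ℝ} (hL : 0 < L) :
    μ.restrict P {x | ∃ n, 4 * L < |𝒬.partialTransform η f p n x|}
      ≤ 8 * ENNReal.ofReal ((∫ x in P, g x ∂μ) / L) := by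
  have hsub : {x | ∃ n, 4 * L < |𝒬.partialTransform η f p n x|} ⊆
      {x | ∃ n, 2 * L < |𝒬.partialTransform η (fun y => max (f y) 0) p n x|} ∪
      {x | ∃ n, 2 * L < |𝒬.partialTransform η (fun y => max (-f y) 0) p n x|} := by
    rintro x ⟨n, hn⟩
    rw [partialTransform_posPart_sub η hf] at hn
    by_contra hcon
    have hcon' := not_or.1 hcon
    have c1 := not_lt.1 (not_exists.1 hcon'.1 n)
    have c2 := not_lt.1 (not_exists.1 hcon'.2 n)
    have := abs_sub (𝒬.partialTransform η (fun y => max (f y) 0) p n x)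
      (𝒬.partialTransform η (fun y => max (-f y) 0) p n x)
    linarith
  have bound : ∀ h : Ω → ℝ, Integrable h μ → (∀ x, h x ≤ g x) →
      4 * ENNReal.ofReal ((∫ x in P, h x ∂μ) / L)
        ≤ 4 * ENNReal.ofReal ((∫ x in P, g x ∂μ) / L) := fun h hh hle => by
    refine mul_le_mul_right (ENNReal.ofReal_le_ofReal (div_le_div_of_nonneg_right ?_ hL.le)) 4
    exact integral_mono hh.restrict hg.restrict hle
  calc _ ≤ _ := measure_mono hsub
    _ ≤ _ := measure_union_le _ _
    _ ≤ _ := add_le_add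
      ((measure_partialTransform_le_of_nonneg hP hη hf.pos_part (fun x => le_max_right _ _) hL).trans
        (bound _ hf.pos_part fun x => max_le ((le_abs_self _).trans (hfg x))
          ((abs_nonneg _).trans (hfg x))))
      ((measure_partialTransform_le_of_nonneg hP hη hf.neg_part (fun x => le_max_right _ _) hL).trans
        (bound _ hf.neg_part fun x => max_le ((neg_le_abs _).trans (hfg x))
          ((abs_nonneg _).trans (hfg x))))
    _ = _ := by ring

theorem ae_tendsto_partialTransform (hP : P ∈ 𝒬.part p) {ε : Set Ω → 𝕜}
    (hε : ∀ Q ∈ 𝒬.atoms, ‖ε Q‖ ≤ 1) {f : Ω → 𝕜} (hf : Integrable f μ) :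
    ∀ᵐ x ∂μ.restrict P, ∃ c, Tendsto (fun n => 𝒬.partialTransform ε f p n x) atTop (𝓝 c) := by
  have h1 : ∀ Q ∈ 𝒬.atoms, |RCLike.re (ε Q)| ≤ 1 := fun Q hQ =>
    (RCLike.abs_re_le_norm _).trans (hε Q hQ)
  have h2 : ∀ Q ∈ 𝒬.atoms, |RCLike.im (ε Q)| ≤ 1 := fun Q hQ =>
    (RCLike.abs_im_le_norm _).trans (hε Q hQ)
  filter_upwards [ae_tendsto_partialTransform_real hP h1 hf.re,
    ae_tendsto_partialTransform_real hP h1 hf.im, ae_tendsto_partialTransform_real hP h2 hf.re,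
    ae_tendsto_partialTransform_real hP h2 hf.im] with x ⟨a, ha⟩ ⟨b, hb⟩ ⟨c, hc⟩ ⟨d, hd⟩
  refine ⟨((a - d : ℝ) : 𝕜) + ((b + c : ℝ) : 𝕜) * RCLike.I, ?_⟩
  refine ((((RCLike.continuous_ofReal (K := 𝕜)).tendsto _).comp (ha.sub hd)).add
    ((((RCLike.continuous_ofReal (K := 𝕜)).tendsto _).comp (hb.add hc)).mul_const
      RCLike.I)).congr fun n => ?_
  simp only [Function.comp_apply]
  rw [← re_partialTransform ε hf, ← im_partialTransform ε hf, RCLike.re_add_im]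

/-- The weak-type inequality for the transform localized to an atom. -/
theorem measure_partialTransform_le (hP : P ∈ 𝒬.part p) {ε : Set Ω → 𝕜}
    (hε : ∀ Q ∈ 𝒬.atoms, ‖ε Q‖ ≤ 1) {f : Ω → 𝕜} (hf : Integrable f μ) {L : ℝ} (hL : 0 < L) :
    μ.restrict P {x | ∃ n, 16 * L < ‖𝒬.partialTransform ε f p n x‖}
      ≤ 32 * ENNReal.ofReal ((∫ x in P, ‖f x‖ ∂μ) / L) := by
  have h1 : ∀ Q ∈ 𝒬.atoms, |RCLike.re (ε Q)| ≤ 1 := fun Q hQ =>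
    (RCLike.abs_re_le_norm _).trans (hε Q hQ)
  have h2 : ∀ Q ∈ 𝒬.atoms, |RCLike.im (ε Q)| ≤ 1 := fun Q hQ =>
    (RCLike.abs_im_le_norm _).trans (hε Q hQ)
  have w1 := measure_partialTransform_le_real hP h1 hf.re hf.norm
    (fun x => RCLike.abs_re_le_norm _) hL
  have w2 := measure_partialTransform_le_real hP h2 hf.im hf.norm
    (fun x => RCLike.abs_im_le_norm _) hL
  have w3 := measure_partialTransform_le_real hP h1 hf.im hf.norm
    (fun x => RCLike.abs_im_le_norm _) hL
  have w4 := measure_partialTransform_le_real hP h2 hf.re hf.norm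
    (fun x => RCLike.abs_re_le_norm _) hL
  -- The four real transforms each cost `8` in measure, giving `32`. Where all stay below `4L`, the
  -- real and imaginary parts are at most `8L` and the norm is at most `16L`.
  refine le_trans (measure_mono ?_) ((measure_union_le _ _).trans (add_le_add
    ((measure_union_le _ _).trans (add_le_add w1 w2))
    ((measure_union_le _ _).trans (add_le_add w3 w4))) |>.trans_eq (by ring))
  rintro x ⟨n, hn⟩
  by_contra hcon
  obtain ⟨hc1, hc2⟩ := not_or.1 hcon
  obtain ⟨hc11, hc12⟩ := not_or.1 hc1
  obtain ⟨hc21, hc22⟩ := not_or.1 hc2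
  have c1 := not_lt.1 (not_exists.1 hc11 n)
  have c2 := not_lt.1 (not_exists.1 hc12 n)
  have c3 := not_lt.1 (not_exists.1 hc21 n)
  have c4 := not_lt.1 (not_exists.1 hc22 n)
  set z := 𝒬.partialTransform ε f p n x with hz
  have e1 : |RCLike.re z| ≤ 8 * L := by
    rw [hz, re_partialTransform ε hf]
    exact (abs_sub _ _).trans (by linarith)
  have e2 : |RCLike.im z| ≤ 8 * L := by
    rw [hz, im_partialTransform ε hf]
    exact (abs_add_le _ _).trans (by linarith)
  have e3 : ‖z‖ ≤ |RCLike.re z| + |RCLike.im z| := by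
    conv_lhs => rw [← RCLike.re_add_im z]
    refine (norm_add_le _ _).trans ?_
    rw [norm_mul, RCLike.norm_ofReal, RCLike.norm_ofReal]
    exact add_le_add_right (mul_le_of_le_one_right (abs_nonneg _) (by rw [RCLike.norm_I]; split_ifs <;> norm_num)) _
  linarith

theorem measure_average_le (hP : P ∈ 𝒬.part p) {f : Ω → ℝ} (hf : Integrable f μ)
    (h0 : ∀ x, 0 ≤ f x) {L : ℝ} (hL : 0 < L) :
    μ.restrict P {x | ∃ n : ℕ, L < 𝒬.average f (p + n) x}
      ≤ ENNReal.ofReal ((∫ x in P, f x ∂μ) / L) := by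
  have := isFiniteMeasure_restrict hP
  rw [← setIntegral_average_zero f hP]
  exact MartingaleTransform.measure_exists_lt_martingale_le (martingale_average hf hP)
    (fun n x => average_nonneg h0 _ x) hL

end Transform

end PartitionFiltration

/-! ### The stopping family: sparseness and the recursive pointwise bound. -/

namespace PartitionFiltration

variable {Ω : Type*} [MeasurableSpace Ω] {μ : Measure Ω} (𝒬 : PartitionFiltration Ω μ)
variable {𝕜 : Type*} [RCLike 𝕜]

open Classical in
/-- A level at which the atom `P` occurs. -/
def level (P : Set Ω) : ℤ := if h : ∃ n, P ∈ 𝒬.part n then h.choose else 0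

/-- The point `x ∈ P` is bad at time `n` if the transform started at `P` or the average of `‖f‖`
is large compared with the average of `‖f‖` over `P`. -/
def IsBad (ε : Set Ω → 𝕜) (f : Ω → 𝕜) (P : Set Ω) (n : ℕ) (x : Ω) : Prop :=
  16 * (66 * ⨍ y in P, ‖f y‖ ∂μ) < ‖𝒬.partialTransform ε f (𝒬.level P) n x‖ ∨
    66 * ⨍ y in P, ‖f y‖ ∂μ < 𝒬.average (fun y => ‖f y‖) (𝒬.level P + n) x

/-- The cells of the first bad times inside `P`. -/
def stoppingChildren (ε : Set Ω → 𝕜) (f : Ω → 𝕜) (P : Set Ω) : Set (Set Ω) :=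
  {R | ∃ x ∈ P, ∃ n : ℕ, 𝒬.IsBad ε f P n x ∧ (∀ k < n, ¬ 𝒬.IsBad ε f P k x) ∧
    R = 𝒬.cell (𝒬.level P + n) x}

/-- The family generated from `Q₀` by iterating stopping children. -/
inductive StoppingFamily (ε : Set Ω → 𝕜) (f : Ω → 𝕜) (Q₀ : Set Ω) : Set Ω → Prop
  | base : StoppingFamily ε f Q₀ Q₀
  | step (P R : Set Ω) : StoppingFamily ε f Q₀ P → R ∈ 𝒬.stoppingChildren ε f P →
      StoppingFamily ε f Q₀ R

variable {𝒬} {ε : Set Ω → 𝕜} {f : Ω → 𝕜} {P Q₀ : Set Ω}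

theorem mem_part_level (hP : P ∈ 𝒬.atoms) : P ∈ 𝒬.part (𝒬.level P) := by
  have h := exists_part hP
  rw [level, dif_pos h]
  exact h.choose_spec

theorem setAverage_norm_nonneg (f : Ω → 𝕜) (P : Set Ω) : 0 ≤ ⨍ y in P, ‖f y‖ ∂μ := by
  rw [setAverage_eq, smul_eq_mul]
  exact mul_nonneg (inv_nonneg.2 measureReal_nonneg) (integral_nonneg fun _ => norm_nonneg _)

section Increment

theorem increment_congr {m n : ℤ} (hmn : m < n) {x y : Ω} (h : 𝒬.cell n x = 𝒬.cell n y) :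
    𝒬.increment ε f m x = 𝒬.increment ε f m y := by
  simp only [increment, average, cell_eq_of_le hmn.le h, cell_eq_of_le (show m + 1 ≤ n from hmn) h]

theorem increment_eq_zero {m : ℤ} {x : Ω} (h : 𝒬.cell (m + 1) x = 𝒬.cell m x) :
    𝒬.increment ε f m x = 0 := by
  simp only [increment, average, h, sub_self, mul_zero]

theorem norm_increment_le (hε : ∀ Q ∈ 𝒬.atoms, ‖ε Q‖ ≤ 1) (m : ℤ) (x : Ω) :
    ‖𝒬.increment ε f m x‖ ≤ ‖𝒬.average f (m + 1) x - 𝒬.average f m x‖ := by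
  rw [increment, norm_mul]
  exact mul_le_of_le_one_left (norm_nonneg _) (hε _ (𝒬.cell_mem_atoms m x))

theorem partialTransform_congr {p : ℤ} {n : ℕ} {x y : Ω}
    (h : 𝒬.cell (p + n) x = 𝒬.cell (p + n) y) :
    𝒬.partialTransform ε f p n x = 𝒬.partialTransform ε f p n y :=
  Finset.sum_congr rfl fun k hk => increment_congr
    (by have := Finset.mem_range.1 hk; omega) h

theorem partialTransform_eq_sum_Ico (p : ℤ) (n : ℕ) (x : Ω) :
    𝒬.partialTransform ε f p n x = ∑ m ∈ Finset.Ico p (p + n), 𝒬.increment ε f m x := by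
  induction n with
  | zero => simp [partialTransform]
  | succ n ih =>
    have e : Finset.Ico p (p + (n + 1 : ℕ)) = insert (p + n) (Finset.Ico p (p + n)) := by
      ext m; simp only [Finset.mem_Ico, Finset.mem_insert]; omega
    rw [e, Finset.sum_insert (by simp), ← ih, partialTransform, Finset.sum_range_succ, add_comm]
    rfl

theorem sum_Ico_eq_add {p q c : ℤ} (hpq : p ≤ q) (hqc : q ≤ c) (φ : ℤ → 𝕜) :
    ∑ m ∈ Finset.Ico p c, φ m = ∑ m ∈ Finset.Ico p q, φ m + ∑ m ∈ Finset.Ico q c, φ m := by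
  rw [← Finset.Ico_union_Ico_eq_Ico hpq hqc,
    Finset.sum_union (Finset.Ico_disjoint_Ico_consecutive p q c)]

theorem cell_eq_of_between {R : Set Ω} {a b m : ℤ} (ha : R ∈ 𝒬.part a) (hb : R ∈ 𝒬.part b) {x : Ω}
    (hx : x ∈ R) (ham : a ≤ m) (hmb : m ≤ b) : 𝒬.cell m x = R := by
  refine Set.Subset.antisymm ?_ ?_
  · exact cell_subset_of_mem ham ha hx
  · rw [← cell_eq_of_mem hb hx]
    exact cell_antitone x hmb

/-- The transform started at an atom does not depend on the level chosen for it. -/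
theorem sum_Ico_increment_eq {R : Set Ω} {a b : ℤ} (ha : R ∈ 𝒬.part a) (hb : R ∈ 𝒬.part b) {x : Ω}
    (hx : x ∈ R) (c : ℤ) : ∑ m ∈ Finset.Ico a c, 𝒬.increment ε f m x
      = ∑ m ∈ Finset.Ico b c, 𝒬.increment ε f m x := by
  wlog hab : a ≤ b generalizing a b
  · exact (this hb ha (not_le.1 hab).le).symm
  refine (Finset.sum_subset (Finset.Ico_subset_Ico_left hab) fun m hm hm' => ?_).symm
  simp only [Finset.mem_Ico, not_and_or, not_le, not_lt] at hm hm'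
  have hmb : m < b := by omega
  apply increment_eq_zero
  rw [cell_eq_of_between ha hb hx hm.1 hmb.le, cell_eq_of_between ha hb hx (by omega) hmb]

end Increment

section Stopping

theorem isBad_congr {n : ℕ} {x y : Ω} (h : 𝒬.cell (𝒬.level P + n) x = 𝒬.cell (𝒬.level P + n) y) :
    𝒬.IsBad ε f P n x ↔ 𝒬.IsBad ε f P n y := by
  rw [IsBad, IsBad, partialTransform_congr h, average, average, h]

/-- While the cell is still `P`, all increments vanish and the average is unchanged. This makes
stopping children strictly smaller than `P`. -/
theorem not_isBad_of_cell_eq (hP : P ∈ 𝒬.atoms) {n : ℕ} {x : Ω}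
    (h : 𝒬.cell (𝒬.level P + n) x = P) : ¬ 𝒬.IsBad ε f P n x := by
  have h0 := setAverage_norm_nonneg (μ := μ) f P
  have hx : x ∈ P := h ▸ 𝒬.mem_cell _ x
  have hpn : P ∈ 𝒬.part (𝒬.level P + n) := by
    have := 𝒬.cell_mem_part (𝒬.level P + n) x
    rwa [h] at this
  rw [IsBad, partialTransform_eq_sum_Ico, sum_Ico_increment_eq (mem_part_level hP) hpn hx,
    average, h]
  simp only [Finset.Ico_self, Finset.sum_empty, norm_zero, not_or, not_lt]
  constructor <;> linarith

theorem ssubset_of_mem_stoppingChildren (hP : P ∈ 𝒬.atoms) {R : Set Ω}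
    (hR : R ∈ 𝒬.stoppingChildren ε f P) : R ⊂ P := by
  obtain ⟨x, hx, n, hbad, -, rfl⟩ := hR
  refine (cell_subset_of_mem (by omega) (mem_part_level hP) hx).ssubset_of_ne fun h => ?_
  exact not_isBad_of_cell_eq hP h hbad

theorem mem_atoms_of_mem_stoppingChildren {R : Set Ω} (hR : R ∈ 𝒬.stoppingChildren ε f P) :
    R ∈ 𝒬.atoms := by
  obtain ⟨x, hx, n, hbad, -, rfl⟩ := hR
  exact 𝒬.cell_mem_atoms _ _

/-- Badness at a given time is constant on the cells of that time, so a common point `z` has the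
same first bad time in both descriptions. -/
theorem stoppingChildren_eq_of_mem {R R' : Set Ω} (hR : R ∈ 𝒬.stoppingChildren ε f P)
    (hR' : R' ∈ 𝒬.stoppingChildren ε f P) {z : Ω} (hz : z ∈ R) (hz' : z ∈ R') : R = R' := by
  obtain ⟨x, hx, n, hbad, hfirst, rfl⟩ := hR
  obtain ⟨x', hx', n', hbad', hfirst', rfl⟩ := hR'
  rw [mem_cell_iff] at hz hz'
  have hlt : ∀ {y y' : Ω} {k k' : ℕ}, 𝒬.cell (𝒬.level P + k) z = 𝒬.cell (𝒬.level P + k) y →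
      𝒬.cell (𝒬.level P + k') z = 𝒬.cell (𝒬.level P + k') y' → 𝒬.IsBad ε f P k y →
      (∀ j < k', ¬ 𝒬.IsBad ε f P j y') → ¬ k < k' := by
    intro y y' k k' h h' hb hf hkk
    refine hf k hkk ((isBad_congr ?_).1 hb)
    rw [← h]
    exact cell_eq_of_le (by omega) h'
  have : n = n' := by
    have h1 := hlt hz hz' hbad hfirst'
    have h2 := hlt hz' hz hbad' hfirst
    omega
  subst this
  rw [← hz, ← hz']

/-- The degenerate case in which both thresholds are zero and the weak-type inequality, which needs
`0 < L`, says nothing. -/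
theorem not_isBad_of_setAverage_eq_zero (hf : Integrable f μ)
    (hP : P ∈ 𝒬.atoms) (h : ⨍ y in P, ‖f y‖ ∂μ = 0) {x : Ω} (hx : x ∈ P) (n : ℕ) :
    ¬ 𝒬.IsBad ε f P n x := by
  have hI : ∫ y in P, ‖f y‖ ∂μ = 0 := by
    rw [setAverage_eq, smul_eq_mul] at h
    exact (mul_eq_zero.1 h).resolve_left (inv_ne_zero (measureReal_pos hP).ne')
  have ha : ∀ k : ℕ, 𝒬.average (fun y => ‖f y‖) (𝒬.level P + k) x = 0 := by
    intro k
    have hsub : 𝒬.cell (𝒬.level P + k) x ⊆ P :=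
      cell_subset_of_mem (by omega) (mem_part_level hP) hx
    have h1 : ∫ y in 𝒬.cell (𝒬.level P + k) x, ‖f y‖ ∂μ ≤ ∫ y in P, ‖f y‖ ∂μ :=
      setIntegral_mono_set hf.norm.integrableOn (ae_of_all _ fun _ => norm_nonneg _)
        hsub.eventuallyLE
    have h2 : 0 ≤ ∫ y in 𝒬.cell (𝒬.level P + k) x, ‖f y‖ ∂μ :=
      integral_nonneg fun _ => norm_nonneg _
    rw [average, setAverage_eq, le_antisymm (h1.trans_eq hI) h2, smul_zero]
  have hb : ∀ k : ℕ, 𝒬.average f (𝒬.level P + k) x = 0 := fun k =>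
    norm_le_zero_iff.1 ((norm_average_le f _ x).trans_eq (ha k))
  have hc : 𝒬.partialTransform ε f (𝒬.level P) n x = 0 := by
    refine Finset.sum_eq_zero fun k _ => ?_
    have h1 := hb (k + 1)
    rw [Nat.cast_succ, ← add_assoc] at h1
    rw [increment, h1, hb k, sub_self, mul_zero]
  simp [IsBad, hc, ha n, h]

/-- The stopping children of `P` cover at most half of `P`. -/
theorem tsum_measure_stoppingChildren_le [SigmaFinite μ] (hε : ∀ Q ∈ 𝒬.atoms, ‖ε Q‖ ≤ 1)
    (hf : Integrable f μ) (hP : P ∈ 𝒬.atoms) :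
    ∑' R : 𝒬.stoppingChildren ε f P, μ (R : Set Ω) ≤ μ P / 2 := by
  have hcount : (𝒬.stoppingChildren ε f P).Countable :=
    (Set.countable_iUnion 𝒬.part_countable).mono fun R hR => mem_atoms_of_mem_stoppingChildren hR
  have hdisj : (𝒬.stoppingChildren ε f P).PairwiseDisjoint id := fun R hR R' hR' hne =>
    Set.disjoint_left.2 fun z hz hz' => hne (stoppingChildren_eq_of_mem hR hR' hz hz')
  have e := measure_biUnion (μ := μ) hcount hdisj fun R hR =>
    measurableSet_of_mem_atoms (mem_atoms_of_mem_stoppingChildren hR)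
  simp only [id] at e
  rw [← e]
  have hsub : (⋃ R ∈ 𝒬.stoppingChildren ε f P, R) ⊆ {x | ∃ n, 𝒬.IsBad ε f P n x} ∩ P := by
    intro z hz
    obtain ⟨R, hR, hzR⟩ := Set.mem_iUnion₂.1 hz
    refine ⟨?_, (ssubset_of_mem_stoppingChildren hP hR).subset hzR⟩
    obtain ⟨x, hx, n, hbad, -, rfl⟩ := hR
    exact ⟨n, (isBad_congr (mem_cell_iff.1 hzR)).2 hbad⟩
  refine (measure_mono hsub).trans ?_
  rcases (setAverage_norm_nonneg (μ := μ) f P).eq_or_lt with h0 | h0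
  · have : {x | ∃ n, 𝒬.IsBad ε f P n x} ∩ P = ∅ := by
      refine Set.eq_empty_of_forall_notMem fun x hx => ?_
      obtain ⟨⟨n, hn⟩, hxP⟩ := hx
      exact not_isBad_of_setAverage_eq_zero hf hP h0.symm hxP n hn
    rw [this, measure_empty]
    exact zero_le
  · rw [← Measure.restrict_apply' (measurableSet_of_mem_atoms hP)]
    set a := ⨍ y in P, ‖f y‖ ∂μ with ha
    have hL : 0 < 66 * a := by positivity
    have hμ : 0 < μ.real P := measureReal_pos hP
    have hI : (∫ y in P, ‖f y‖ ∂μ) / (66 * a) = μ.real P / 66 := by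
      have : ∫ y in P, ‖f y‖ ∂μ = μ.real P * a := by
        rw [ha, setAverage_eq, smul_eq_mul, mul_inv_cancel_left₀ hμ.ne']
      rw [this]
      field_simp
    have w1 := measure_partialTransform_le (mem_part_level hP) hε hf hL
    have w2 := measure_average_le (mem_part_level hP) hf.norm (fun _ => norm_nonneg _) hL
    rw [hI] at w1 w2
    calc μ.restrict P {x | ∃ n, 𝒬.IsBad ε f P n x}
        ≤ μ.restrict P ({x | ∃ n, 16 * (66 * a) < ‖𝒬.partialTransform ε f (𝒬.level P) n x‖} ∪
          {x | ∃ n : ℕ, 66 * a < 𝒬.average (fun y => ‖f y‖) (𝒬.level P + n) x}) :=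
          measure_mono fun x ⟨n, hn⟩ => hn.imp (fun h => ⟨n, h⟩) fun h => ⟨n, h⟩
      _ ≤ _ := (measure_union_le _ _).trans (add_le_add w1 w2)
      _ = μ P / 2 := by
          -- The choice of `66`: the transform costs `32/66`, the maximal average `1/66`, together
          -- one half.
          have h33 : 32 * ENNReal.ofReal (μ.real P / 66) + ENNReal.ofReal (μ.real P / 66)
              = ENNReal.ofReal (μ.real P / 2) := by
            rw [← ENNReal.ofReal_ofNat 32, ← ENNReal.ofReal_mul (by norm_num),
              ← ENNReal.ofReal_add (by positivity) (by positivity)]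
            congr 1; ring
          rw [h33, ENNReal.ofReal_div_of_pos (by norm_num),
            ofReal_measureReal (measure_lt_top_of_mem_atoms hP).ne, ENNReal.ofReal_ofNat]

end Stopping

section Family

theorem StoppingFamily.mem_atoms (hQ₀ : Q₀ ∈ 𝒬.atoms) {R : Set Ω}
    (hR : 𝒬.StoppingFamily ε f Q₀ R) : R ∈ 𝒬.atoms := by
  cases hR with
  | base => exact hQ₀
  | step P R hP h => exact mem_atoms_of_mem_stoppingChildren h

theorem StoppingFamily.subset (hQ₀ : Q₀ ∈ 𝒬.atoms) {R : Set Ω}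
    (hR : 𝒬.StoppingFamily ε f Q₀ R) : R ⊆ Q₀ := by
  induction hR with
  | base => exact subset_rfl
  | step P R hP h ih => exact (ssubset_of_mem_stoppingChildren (hP.mem_atoms hQ₀) h).subset.trans ih

theorem level_lt_level {R : Set Ω} (hP : P ∈ 𝒬.atoms) (hR : R ∈ 𝒬.atoms) (h : R ⊂ P) :
    𝒬.level P < 𝒬.level R :=
  level_lt_of_ssubset (mem_part_level hP) (mem_part_level hR) h

/-- A member of the stopping family strictly inside `P` lies in a stopping child of `P`. -/
theorem StoppingFamily.exists_stoppingChildren (hQ₀ : Q₀ ∈ 𝒬.atoms) (N : ℕ) :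
    ∀ {P R : Set Ω}, 𝒬.StoppingFamily ε f Q₀ P → 𝒬.StoppingFamily ε f Q₀ R → R ⊂ P →
      𝒬.level R ≤ 𝒬.level Q₀ + N → ∃ R' ∈ 𝒬.stoppingChildren ε f P, R ⊆ R' := by
  induction N with
  | zero =>
    intro P R hP hR hRP hN
    have := level_lt_level hQ₀ (hR.mem_atoms hQ₀) (hRP.trans_subset (hP.subset hQ₀))
    omega
  | succ N ih =>
    intro P R hP hR hRP hN
    have hPa := hP.mem_atoms hQ₀
    have hRa := hR.mem_atoms hQ₀
    cases hR with
    | base => exact absurd (hP.subset hQ₀) hRP.not_subset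
    | step P' _ hP' hRP' =>
      have hP'a := hP'.mem_atoms hQ₀
      have hss := ssubset_of_mem_stoppingChildren hP'a hRP'
      obtain ⟨x, hx⟩ := nonempty_of_mem_atoms hRa
      rcases eq_or_ne P P' with rfl | hne
      · exact ⟨R, hRP', subset_rfl⟩
      -- Compare `P` with the member `P'` that generated `R`. If `P ⊂ P'`, induction puts `P` in a
      -- stopping child of `P'`, which must be `R` as it meets `R`, against `R ⊂ P`. If `P' ⊂ P`,
      -- induction applies to `P'`.
      rcases subset_or_subset_of_mem hPa hP'a (hRP.subset hx) (hss.subset hx) with h | h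
      · have hlt := level_lt_level hPa hRa hRP
        obtain ⟨R'', hR'', hPR''⟩ := ih hP' hP (h.ssubset_of_ne hne) (by omega)
        have : R = R'' := stoppingChildren_eq_of_mem hRP' hR'' hx (hPR'' (hRP.subset hx))
        exact absurd (this ▸ hPR'') hRP.not_subset
      · have hlt := level_lt_level hP'a hRa hss
        obtain ⟨R'', hR'', hPR''⟩ := ih hP hP' (h.ssubset_of_ne hne.symm) (by omega)
        exact ⟨R'', hR'', hss.subset.trans hPR''⟩

/-- A maximal member strictly inside `P` lies in a stopping child of `P`, itself a competitor, and
so equals it; the half-measure bound for stopping children then applies. -/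
theorem isSparse_stoppingFamily [SigmaFinite μ] (hε : ∀ Q ∈ 𝒬.atoms, ‖ε Q‖ ≤ 1)
    (hf : Integrable f μ) (hQ₀ : Q₀ ∈ 𝒬.atoms) :
    𝒬.IsSparse {R | 𝒬.StoppingFamily ε f Q₀ R} := by
  refine ⟨fun R hR => StoppingFamily.mem_atoms hQ₀ hR, fun P hP => ?_⟩
  have hPa : P ∈ 𝒬.atoms := StoppingFamily.mem_atoms hQ₀ hP
  have hsub : {Q : Set Ω | Maximal (fun R => R ∈ {R | 𝒬.StoppingFamily ε f Q₀ R} ∧ R ⊂ P) Q}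
      ⊆ 𝒬.stoppingChildren ε f P := by
    intro R hR
    obtain ⟨⟨hRS, hRP⟩, hmax⟩ := hR
    have hRS' : 𝒬.StoppingFamily ε f Q₀ R := hRS
    obtain ⟨R', hR', hRR'⟩ := StoppingFamily.exists_stoppingChildren hQ₀
      (𝒬.level R - 𝒬.level Q₀).toNat hP hRS' hRP (by omega)
    have hR'S : 𝒬.StoppingFamily ε f Q₀ R' := .step P R' hP hR'
    have : R' ⊆ R := hmax ⟨hR'S, ssubset_of_mem_stoppingChildren hPa hR'⟩ hRR'
    rwa [hRR'.antisymm this]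
  exact (ENNReal.tsum_mono_subtype (fun R : Set Ω => μ R) hsub).trans
    (tsum_measure_stoppingChildren_le hε hf hPa)

theorem ofReal_setAverage_norm (hf : Integrable f μ) (P : Set Ω) :
    ENNReal.ofReal (⨍ y in P, ‖f y‖ ∂μ) = ⨍⁻ y in P, ‖f y‖ₑ ∂μ := by
  rw [ofReal_setAverage hf.norm.integrableOn (ae_of_all _ fun _ => norm_nonneg _), setLAverage_eq]
  simp only [ofReal_norm]

theorem add_sparseOperator_le {S : Set (Set Ω)} {R : Set Ω} (hPS : P ∈ S) (hRP : R ⊂ P) {x : Ω}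
    (hx : x ∈ P) (g : Ω → ℝ≥0∞) : (⨍⁻ y in P, g y ∂μ) + sparseOperator μ {Q | Q ∈ S ∧ Q ⊆ R} g x
      ≤ sparseOperator μ {Q | Q ∈ S ∧ Q ⊆ P} g x := by
  set F : Set Ω → ℝ≥0∞ := fun Q => Q.indicator (fun _ => ⨍⁻ y in Q, g y ∂μ) x with hF
  have hFP : ⨍⁻ y in P, g y ∂μ = F P := by simp only [hF, Set.indicator_of_mem hx]
  have hdisj : Disjoint {P} {Q | Q ∈ S ∧ Q ⊆ R} := by
    rw [Set.disjoint_singleton_left]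
    exact fun h => hRP.not_subset h.2
  have e := ENNReal.summable.tsum_union_disjoint (f := F) hdisj ENNReal.summable
  rw [tsum_singleton] at e
  calc _ = ∑' Q : ({P} ∪ {Q | Q ∈ S ∧ Q ⊆ R} : Set (Set Ω)), F Q := by rw [e, ← hFP]; rfl
    _ ≤ ∑' Q : {Q | Q ∈ S ∧ Q ⊆ P}, F Q := by
      refine ENNReal.tsum_mono_subtype F (Set.union_subset ?_ ?_)
      · exact Set.singleton_subset_iff.2 ⟨hPS, subset_rfl⟩
      · exact fun Q hQ => ⟨hQ.1, hQ.2.trans hRP.subset⟩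

theorem setLAverage_le_sparseOperator {S : Set (Set Ω)} (hPS : P ∈ S) {x : Ω} (hx : x ∈ P)
    (g : Ω → ℝ≥0∞) : ⨍⁻ y in P, g y ∂μ ≤ sparseOperator μ S g x := by
  have := ENNReal.le_tsum (f := fun Q : S => (Q : Set Ω).indicator
    (fun _ => ⨍⁻ y in (Q : Set Ω), g y ∂μ) x) ⟨P, hPS⟩
  rw [Set.indicator_of_mem hx] at this
  exact this

/-- At a stopping time the transform is controlled by the averages of the atom and of the child. -/
theorem norm_partialTransform_le_of_first (hε : ∀ Q ∈ 𝒬.atoms, ‖ε Q‖ ≤ 1) (hP : P ∈ 𝒬.atoms)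
    {x : Ω} (hx : x ∈ P) {n : ℕ} (hbad : 𝒬.IsBad ε f P n x)
    (hfirst : ∀ k < n, ¬ 𝒬.IsBad ε f P k x) :
    ‖𝒬.partialTransform ε f (𝒬.level P) n x‖ ≤ 1122 * (⨍ y in P, ‖f y‖ ∂μ)
      + 𝒬.average (fun y => ‖f y‖) (𝒬.level P + n) x := by
  obtain _ | n := n
  · exact absurd hbad (not_isBad_of_cell_eq hP
      (by rw [Nat.cast_zero, add_zero]; exact cell_eq_of_mem (mem_part_level hP) hx))
  -- One step earlier neither threshold is passed, so `1122 = 16 * 66 + 66` bounds the transform so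
  -- far and the old average in the last increment; the new average is kept.
  have h := hfirst n n.lt_succ_self
  rw [IsBad, not_or, not_lt, not_lt] at h
  have h1 : ‖𝒬.increment ε f (𝒬.level P + n) x‖ ≤
      𝒬.average (fun y => ‖f y‖) (𝒬.level P + n + 1) x
        + 𝒬.average (fun y => ‖f y‖) (𝒬.level P + n) x :=
    (norm_increment_le hε _ x).trans ((norm_sub_le _ _).trans
      (add_le_add (norm_average_le f _ x) (norm_average_le f _ x)))
  have h2 : 𝒬.partialTransform ε f (𝒬.level P) (n + 1) x
      = 𝒬.partialTransform ε f (𝒬.level P) n x + 𝒬.increment ε f (𝒬.level P + n) x :=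
    Finset.sum_range_succ _ _
  rw [h2, Nat.cast_succ, ← add_assoc]
  refine (norm_add_le _ _).trans ?_
  linarith [h.1, h.2]

/-- The pointwise sparse bound for the transform started at a member of the family. -/
theorem enorm_sum_increment_add_le (hε : ∀ Q ∈ 𝒬.atoms, ‖ε Q‖ ≤ 1) (hf : Integrable f μ)
    (hQ₀ : Q₀ ∈ 𝒬.atoms) (x : Ω) (c : ℤ) (N : ℕ) :
    ∀ {P : Set Ω}, 𝒬.StoppingFamily ε f Q₀ P → x ∈ P → c ≤ 𝒬.level P + N →
      ‖∑ m ∈ Finset.Ico (𝒬.level P) c, 𝒬.increment ε f m x‖ₑ + ⨍⁻ y in P, ‖f y‖ₑ ∂μ ≤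
        1123 * sparseOperator μ {R | 𝒬.StoppingFamily ε f Q₀ R ∧ R ⊆ P} (fun y => ‖f y‖ₑ) x := by
  -- The average over `P` on the left closes the induction: the stopping estimate for `P` leaves an
  -- average over the stopping child `R`, which is absorbed into the induction hypothesis for `R`.
  -- One further average over `P` makes `1123 = 1122 + 1`.
  induction N using Nat.strong_induction_on with
  | _ N ih =>
  intro P hP hx hc
  have hPa := hP.mem_atoms hQ₀
  have hPS : P ∈ {R | 𝒬.StoppingFamily ε f Q₀ R ∧ R ⊆ P} := ⟨hP, subset_rfl⟩
  have ha := setAverage_norm_nonneg (μ := μ) f P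
  by_cases hex : ∃ k : ℕ, 𝒬.level P + k ≤ c ∧ 𝒬.IsBad ε f P k x
  · classical
    have hk := Nat.find_spec hex
    have hmin : ∀ j < Nat.find hex, ¬ 𝒬.IsBad ε f P j x := fun j hj hb =>
      Nat.find_min hex hj ⟨by omega, hb⟩
    set k := Nat.find hex
    set R := 𝒬.cell (𝒬.level P + k) x with hRdef
    have hRc : R ∈ 𝒬.stoppingChildren ε f P := ⟨x, hx, k, hk.2, hmin, rfl⟩
    have hRS : 𝒬.StoppingFamily ε f Q₀ R := .step P R hP hRc
    have hRP := ssubset_of_mem_stoppingChildren hPa hRc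
    have hRa := hRS.mem_atoms hQ₀
    have hxR : x ∈ R := 𝒬.mem_cell _ x
    have hlev := level_lt_level hPa hRa hRP
    have hN : 0 < N := by
      by_contra h0
      have h1 := level_lt_of_ssubset (mem_part_level hPa) (𝒬.cell_mem_part (𝒬.level P + k) x) hRP
      omega
    have ihR := ih (N - 1) (by omega) hRS hxR (by omega)
    have hfirst := norm_partialTransform_le_of_first hε hPa hx hk.2 hmin
    rw [partialTransform_eq_sum_Ico] at hfirst
    -- The chosen level of `R` may differ from `𝒬.level P + k`; the restarted sum is the same from
    -- either.
    rw [sum_Ico_eq_add (q := 𝒬.level P + k) (by omega) hk.1,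
      sum_Ico_increment_eq (𝒬.cell_mem_part (𝒬.level P + k) x) (mem_part_level hRa) hxR]
    have h1 : ‖∑ m ∈ Finset.Ico (𝒬.level P) (𝒬.level P + k), 𝒬.increment ε f m x‖ₑ
        ≤ 1122 * (⨍⁻ y in P, ‖f y‖ₑ ∂μ) + ⨍⁻ y in R, ‖f y‖ₑ ∂μ := by
      rw [← ofReal_setAverage_norm hf, ← ofReal_setAverage_norm hf, ← ofReal_norm,
        ← ENNReal.ofReal_ofNat 1122, ← ENNReal.ofReal_mul (by norm_num),
        ← ENNReal.ofReal_add (by positivity) (setAverage_norm_nonneg f R)]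
      exact ENNReal.ofReal_le_ofReal hfirst
    calc _ ≤ (1122 * (⨍⁻ y in P, ‖f y‖ₑ ∂μ) + ⨍⁻ y in R, ‖f y‖ₑ ∂μ
          + ‖∑ m ∈ Finset.Ico (𝒬.level R) c, 𝒬.increment ε f m x‖ₑ) + ⨍⁻ y in P, ‖f y‖ₑ ∂μ :=
          add_le_add_left ((enorm_add_le _ _).trans (add_le_add_left h1 _)) _
      _ = 1123 * (⨍⁻ y in P, ‖f y‖ₑ ∂μ) +
          (‖∑ m ∈ Finset.Ico (𝒬.level R) c, 𝒬.increment ε f m x‖ₑ + ⨍⁻ y in R, ‖f y‖ₑ ∂μ) := by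
          ring
      _ ≤ 1123 * (⨍⁻ y in P, ‖f y‖ₑ ∂μ) + 1123 * sparseOperator μ
          {Q | Q ∈ {R | 𝒬.StoppingFamily ε f Q₀ R} ∧ Q ⊆ R} (fun y => ‖f y‖ₑ) x :=
          add_le_add_right ihR _
      _ ≤ _ := by
          rw [← mul_add]
          exact mul_le_mul_right (add_sparseOperator_le
            (S := {R | 𝒬.StoppingFamily ε f Q₀ R}) hP hRP hx _) _
  · have hnb : ‖∑ m ∈ Finset.Ico (𝒬.level P) c, 𝒬.increment ε f m x‖
        ≤ 16 * (66 * ⨍ y in P, ‖f y‖ ∂μ) := by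
      rcases le_or_gt (𝒬.level P) c with hle | hlt
      · obtain ⟨k, rfl⟩ := Int.le.dest hle
        have h := not_and.1 (not_exists.1 hex k) le_rfl
        rw [IsBad, not_or, not_lt, partialTransform_eq_sum_Ico] at h
        exact h.1
      · rw [Finset.Ico_eq_empty_of_le hlt.le, Finset.sum_empty, norm_zero]
        positivity
    refine le_trans ?_ (mul_le_mul_right (setLAverage_le_sparseOperator hPS hx _) _)
    rw [← ofReal_setAverage_norm hf, ← ofReal_norm, ← ENNReal.ofReal_ofNat 1123,
      ← ENNReal.ofReal_mul (by norm_num), ← ENNReal.ofReal_add (norm_nonneg _) ha]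
    exact ENNReal.ofReal_le_ofReal (by linarith)

end Family

end PartitionFiltration

/-! ### Coarse levels, truncations as prefix sums, and the final domination. -/

namespace PartitionFiltration

variable {Ω : Type*} [MeasurableSpace Ω] {μ : Measure Ω} {𝒬 : PartitionFiltration Ω μ}
variable {𝕜 : Type*} [RCLike 𝕜] {ε : Set Ω → 𝕜} {f : Ω → 𝕜} {Q₀ : Set Ω}

section Tail

theorem setIntegral_cell_eq (hsupp : ∀ᵐ x ∂μ, x ∉ Q₀ → f x = 0) {m : ℤ} {x : Ω}
    (h : Q₀ ⊆ 𝒬.cell m x) : ∫ y in 𝒬.cell m x, f y ∂μ = ∫ y in Q₀, f y ∂μ := by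
  refine setIntegral_eq_of_subset_of_ae_sdiff_eq_zero
    (measurableSet_of_mem_atoms (𝒬.cell_mem_atoms m x)).nullMeasurableSet h ?_
  filter_upwards [hsupp] with y hy hyc
  exact hy hyc.2

theorem average_eq_zero_of_disjoint (hsupp : ∀ᵐ x ∂μ, x ∉ Q₀ → f x = 0) {m : ℤ} {x : Ω}
    (h : Disjoint (𝒬.cell m x) Q₀) : 𝒬.average f m x = 0 := by
  have : ∫ y in 𝒬.cell m x, f y ∂μ = 0 := by
    refine setIntegral_eq_zero_of_ae_eq_zero ?_
    filter_upwards [hsupp] with y hy hyc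
    exact hy (Set.disjoint_left.1 h hyc)
  rw [average, setAverage_eq, this, smul_zero]

/-- Above `Q₀` both averages are the same integral divided by measures that grow with the cell, so
the norm of the difference is a difference of monotone terms and telescopes. -/
theorem norm_average_sub_le (hsupp : ∀ᵐ x ∂μ, x ∉ Q₀ → f x = 0) {m : ℤ}
    {x : Ω} (h : Q₀ ⊆ 𝒬.cell (m + 1) x) : ‖𝒬.average f (m + 1) x - 𝒬.average f m x‖ ≤
      ‖∫ y in Q₀, f y ∂μ‖ * (μ.real (𝒬.cell (m + 1) x))⁻¹
        - ‖∫ y in Q₀, f y ∂μ‖ * (μ.real (𝒬.cell m x))⁻¹ := by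
  have hpos := measureReal_pos (𝒬.cell_mem_atoms (m + 1) x)
  have hle : μ.real (𝒬.cell (m + 1) x) ≤ μ.real (𝒬.cell m x) :=
    measureReal_mono (cell_succ_subset m x) (measure_lt_top_of_mem_atoms (𝒬.cell_mem_atoms m x)).ne
  rw [average, average, setAverage_eq, setAverage_eq, setIntegral_cell_eq hsupp h,
    setIntegral_cell_eq hsupp (h.trans (cell_succ_subset m x)), ← sub_smul, norm_smul,
    Real.norm_of_nonneg (sub_nonneg.2 (inv_anti₀ hpos hle)), ← mul_sub, mul_comm]

theorem sum_norm_increment_le (hε : ∀ Q ∈ 𝒬.atoms, ‖ε Q‖ ≤ 1)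
    (hsupp : ∀ᵐ x ∂μ, x ∉ Q₀ → f x = 0) {M : ℤ} {x : Ω} (h : Q₀ ⊆ 𝒬.cell M x) (J : ℕ) :
    ∑ j ∈ Finset.range J, ‖𝒬.increment ε f (M - 1 - j) x‖ ≤
      ‖∫ y in Q₀, f y ∂μ‖ * (μ.real (𝒬.cell M x))⁻¹ := by
  suffices ∑ j ∈ Finset.range J, ‖𝒬.increment ε f (M - 1 - j) x‖ ≤
      ‖∫ y in Q₀, f y ∂μ‖ * (μ.real (𝒬.cell M x))⁻¹
        - ‖∫ y in Q₀, f y ∂μ‖ * (μ.real (𝒬.cell (M - J) x))⁻¹ from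
    this.trans (sub_le_self _ (mul_nonneg (norm_nonneg _) (inv_nonneg.2 measureReal_nonneg)))
  induction J with
  | zero => simp
  | succ J ih =>
    rw [Finset.sum_range_succ]
    have e1 : M - 1 - J + 1 = M - J := by ring
    have e2 : M - (J + 1 : ℕ) = M - 1 - J := by push_cast; ring
    have h1 := (norm_increment_le hε (M - 1 - J) x).trans
      (norm_average_sub_le hsupp (h.trans (cell_antitone x (by omega))))
    rw [e1] at h1
    rw [e2]
    linarith

/-- The increments of the transform are absolutely summable towards coarse levels. -/
theorem summable_increment (hε : ∀ Q ∈ 𝒬.atoms, ‖ε Q‖ ≤ 1) (hQ₀ : Q₀ ∈ 𝒬.atoms)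
    (hsupp : ∀ᵐ x ∂μ, x ∉ Q₀ → f x = 0) (n : ℤ) (x : Ω) :
    Summable fun j : ℕ => ‖𝒬.increment ε f (n - 1 - j) x‖ := by
  suffices ∃ M ≤ n, Summable fun j : ℕ => ‖𝒬.increment ε f (M - 1 - j) x‖ by
    obtain ⟨M, hM, hs⟩ := this
    rw [← summable_nat_add_iff (n - M).toNat]
    refine hs.congr fun j => ?_
    congr 2
    push_cast
    omega
  -- The cells of `x` may never reach `Q₀`. Then all sufficiently coarse ones are disjoint from it
  -- and their averages vanish.
  by_cases hex : ∃ m, Q₀ ⊆ 𝒬.cell m x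
  · obtain ⟨m, hm⟩ := hex
    exact ⟨min m n, min_le_right _ _, summable_of_sum_range_le (fun _ => norm_nonneg _)
      (sum_norm_increment_le hε hsupp (hm.trans (cell_antitone x (min_le_left m n))))⟩
  · obtain ⟨q, hq⟩ := exists_part hQ₀
    have hz : ∀ m ≤ q, 𝒬.average f m x = 0 := by
      intro m hm
      refine average_eq_zero_of_disjoint hsupp (Set.disjoint_left.2 fun y hy hyQ => hex ⟨m, ?_⟩)
      rw [← mem_cell_iff.1 hy]
      exact (cell_eq_of_mem hq hyQ).symm.subset.trans (cell_antitone y hm)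
    refine ⟨min q n, min_le_right _ _, summable_zero.congr fun j => ?_⟩
    rw [increment, hz _ (by omega), hz _ (by omega), sub_self, mul_zero, norm_zero]

variable (𝒬) in
/-- The sum of all increments before level `n`. -/
def prefixSum (ε : Set Ω → 𝕜) (f : Ω → 𝕜) (n : ℤ) (x : Ω) : 𝕜 :=
  ∑' j : ℕ, 𝒬.increment ε f (n - 1 - j) x

theorem prefixSum_succ (hε : ∀ Q ∈ 𝒬.atoms, ‖ε Q‖ ≤ 1) (hQ₀ : Q₀ ∈ 𝒬.atoms)
    (hsupp : ∀ᵐ x ∂μ, x ∉ Q₀ → f x = 0) (n : ℤ) (x : Ω) :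
    𝒬.prefixSum ε f (n + 1) x = 𝒬.prefixSum ε f n x + 𝒬.increment ε f n x := by
  rw [prefixSum, (summable_increment hε hQ₀ hsupp (n + 1) x).of_norm.tsum_eq_zero_add, add_comm,
    prefixSum]
  congr 1
  · refine tsum_congr fun j => ?_
    congr 1; push_cast; ring
  · congr 1; push_cast; ring

theorem prefixSum_add (hε : ∀ Q ∈ 𝒬.atoms, ‖ε Q‖ ≤ 1) (hQ₀ : Q₀ ∈ 𝒬.atoms)
    (hsupp : ∀ᵐ x ∂μ, x ∉ Q₀ → f x = 0) (p : ℤ) (n : ℕ) (x : Ω) :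
    𝒬.prefixSum ε f (p + n) x = 𝒬.prefixSum ε f p x + 𝒬.partialTransform ε f p n x := by
  induction n with
  | zero => simp [partialTransform]
  | succ n ih =>
    rw [Nat.cast_succ, ← add_assoc, prefixSum_succ hε hQ₀ hsupp, ih, add_assoc, partialTransform,
      partialTransform, Finset.sum_range_succ]

theorem enorm_prefixSum_le (hε : ∀ Q ∈ 𝒬.atoms, ‖ε Q‖ ≤ 1) (hf : Integrable f μ)
    (hQ₀ : Q₀ ∈ 𝒬.atoms) (hsupp : ∀ᵐ x ∂μ, x ∉ Q₀ → f x = 0) {n : ℤ} {x : Ω}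
    (h : Q₀ ⊆ 𝒬.cell n x) : ‖𝒬.prefixSum ε f n x‖ₑ ≤ ⨍⁻ y in Q₀, ‖f y‖ₑ ∂μ := by
  rw [← ofReal_setAverage_norm hf, ← ofReal_norm]
  refine ENNReal.ofReal_le_ofReal ?_
  refine (norm_tsum_le_tsum_norm (summable_increment hε hQ₀ hsupp n x)).trans ?_
  refine (Real.tsum_le_of_sum_range_le (fun _ => norm_nonneg _)
    (sum_norm_increment_le hε hsupp h)).trans ?_
  rw [setAverage_eq, smul_eq_mul, mul_comm]
  refine mul_le_mul (inv_anti₀ (measureReal_pos hQ₀) (measureReal_mono h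
    (measure_lt_top_of_mem_atoms (𝒬.cell_mem_atoms n x)).ne)) (norm_integral_le_integral_norm _)
    (norm_nonneg _) (inv_nonneg.2 measureReal_nonneg)

/-- The transform converges almost everywhere along the cells of a point. -/
theorem ae_tendsto_prefixSum [SigmaFinite μ] (hε : ∀ Q ∈ 𝒬.atoms, ‖ε Q‖ ≤ 1) (hf : Integrable f μ)
    (hQ₀ : Q₀ ∈ 𝒬.atoms) (hsupp : ∀ᵐ x ∂μ, x ∉ Q₀ → f x = 0) :
    ∀ᵐ x ∂μ, ∃ c, Tendsto (fun n : ℤ => 𝒬.prefixSum ε f n x) atTop (𝓝 c) := by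
  -- Level `0` is an arbitrary starting point: its countably many atoms cover `Ω`, and earlier
  -- increments only add a convergent constant.
  have h : ∀ᵐ x ∂μ, ∀ P ∈ 𝒬.part 0, x ∈ P →
      ∃ c, Tendsto (fun n => 𝒬.partialTransform ε f 0 n x) atTop (𝓝 c) :=
    (ae_ball_iff (𝒬.part_countable 0)).2 fun P hP =>
      (ae_restrict_iff' (𝒬.measurableSet 0 P hP)).1 (ae_tendsto_partialTransform hP hε hf)
  filter_upwards [h] with x hx
  obtain ⟨c, hc⟩ := hx _ (𝒬.cell_mem_part 0 x) (𝒬.mem_cell 0 x)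
  refine ⟨𝒬.prefixSum ε f 0 x + c, ?_⟩
  rw [← Nat.map_cast_int_atTop, tendsto_map'_iff]
  refine (hc.const_add _).congr fun n => ?_
  rw [← prefixSum_add hε hQ₀ hsupp, zero_add]
  rfl

end Tail

section Truncation

theorem cell_succ_mem_children {m : ℤ} {x : Ω} (h : 𝒬.cell (m + 1) x ≠ 𝒬.cell m x) :
    𝒬.cell (m + 1) x ∈ 𝒬.children (𝒬.cell m x) := by
  refine ⟨𝒬.cell_mem_atoms _ x, ⟨𝒬.cell_mem_atoms m x, (cell_succ_subset m x).ssubset_of_ne h⟩, ?_⟩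
  rintro R ⟨hR, hss⟩ -
  obtain ⟨r, hr⟩ := exists_part hR
  have hlt := level_lt_of_ssubset hr (𝒬.cell_mem_part (m + 1) x) hss
  rw [← cell_eq_of_mem hr (hss.subset (𝒬.mem_cell _ x))]
  exact cell_antitone x (by omega)

/-- Only the child containing `x` contributes, and minimality of the parent forces it to be the next
cell. -/
theorem martingaleDiff_cell {m : ℤ} {x : Ω} (h : 𝒬.cell (m + 1) x ≠ 𝒬.cell m x) :
    𝒬.martingaleDiff (𝒬.cell m x) f x = 𝒬.average f (m + 1) x - 𝒬.average f m x := by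
  rw [martingaleDiff, tsum_eq_single ⟨_, cell_succ_mem_children h⟩]
  · rw [Set.indicator_of_mem (𝒬.mem_cell _ x)]
    rfl
  · rintro ⟨Q, hQ, hpar⟩ hne
    refine Set.indicator_of_notMem (fun hx => hne (Subtype.ext ?_)) _
    have hx : x ∈ Q := hx
    obtain ⟨k, hk⟩ := exists_part hQ
    have hlt := level_lt_of_ssubset (𝒬.cell_mem_part m x) hk hpar.1.2
    have hsub : Q ⊆ 𝒬.cell (m + 1) x := by
      rw [← cell_eq_of_mem hk hx]
      exact cell_antitone x hlt
    by_contra hQne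
    have := hpar.2 ⟨𝒬.cell_mem_atoms (m + 1) x, hsub.ssubset_of_ne hQne⟩ (cell_succ_subset m x)
    exact h ((cell_succ_subset m x).antisymm this)

/-- The point lies in a child of `P`, so its chain of cells leaves `P`; take the last level before
it does. -/
theorem exists_cell_of_martingaleDiff_ne_zero {P : Set Ω} (hP : P ∈ 𝒬.atoms) {x : Ω}
    (h : 𝒬.martingaleDiff P f x ≠ 0) : ∃ m, 𝒬.cell m x = P ∧ 𝒬.cell (m + 1) x ≠ 𝒬.cell m x := by
  have : ∃ Q : 𝒬.children P, x ∈ (Q : Set Ω) := by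
    by_contra hcon
    push Not at hcon
    exact h (by simp [martingaleDiff, Set.indicator_of_notMem (hcon _)])
  obtain ⟨⟨Q, hQ, hpar⟩, hx⟩ := this
  have hx : x ∈ Q := hx
  obtain ⟨p, hp⟩ := exists_part hP
  obtain ⟨k, hk⟩ := exists_part hQ
  have hlt := level_lt_of_ssubset hp hk hpar.1.2
  have hxP := hpar.1.2.subset hx
  have hex : ∃ j : ℕ, 𝒬.cell (p + j) x ≠ P := by
    refine ⟨(k - p).toNat, ?_⟩
    rw [show p + ((k - p).toNat : ℤ) = k by omega, cell_eq_of_mem hk hx]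
    exact hpar.1.2.ne
  classical
  have hfind := Nat.find_spec hex
  obtain ⟨i, hi⟩ : ∃ i, Nat.find hex = i + 1 := by
    refine Nat.exists_eq_succ_of_ne_zero fun h0 => hfind ?_
    rw [h0, Nat.cast_zero, add_zero, cell_eq_of_mem hp hxP]
  have hprev : 𝒬.cell (p + i) x = P := not_not.1 (Nat.find_min hex (m := i) (by omega))
  refine ⟨p + i, hprev, ?_⟩
  rwa [hi, Nat.cast_succ, ← add_assoc, ← hprev] at hfind

/-- An atom may persist through many levels, but the chain leaves it only once. -/
theorem eq_of_cell_eq {m m' : ℤ} {x : Ω} (h : 𝒬.cell (m + 1) x ≠ 𝒬.cell m x)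
    (h' : 𝒬.cell (m' + 1) x ≠ 𝒬.cell m' x) (e : 𝒬.cell m x = 𝒬.cell m' x) : m = m' := by
  wlog hlt : m < m' generalizing m m'
  · rcases (not_lt.1 hlt).eq_or_lt with h1 | h1
    · exact h1.symm
    · exact (this h' h e.symm h1).symm
  refine absurd ((cell_succ_subset m x).antisymm ?_) h
  rw [e]
  exact cell_antitone x hlt

/-- The terms of a truncation are the increments along the cells of the point. -/
theorem hasSum_truncation_iff (Q' : Set Ω) (x : Ω) (a : 𝕜) :
    HasSum (fun Q : {Q : Set Ω // Q ∈ 𝒬.atoms ∧ Q' ⊆ Q} => ε Q * 𝒬.martingaleDiff Q f x) a ↔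
      HasSum ({m : ℤ | Q' ⊆ 𝒬.cell m x}.indicator fun m => 𝒬.increment ε f m x) a := by
  -- Jump levels index faithfully the atoms with a nonzero term; the other levels have zero
  -- increment and can be added freely.
  set A : Set ℤ := {m | 𝒬.cell (m + 1) x ≠ 𝒬.cell m x ∧ Q' ⊆ 𝒬.cell m x} with hA
  set G : A → {Q : Set Ω // Q ∈ 𝒬.atoms ∧ Q' ⊆ Q} := fun m =>
    ⟨𝒬.cell m x, 𝒬.cell_mem_atoms m x, m.2.2⟩ with hG
  have hinj : Function.Injective G := fun m m' e =>
    Subtype.ext (eq_of_cell_eq m.2.1 m'.2.1 (congrArg Subtype.val e))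
  rw [← hinj.hasSum_iff]
  · have e1 : (fun Q : {Q : Set Ω // Q ∈ 𝒬.atoms ∧ Q' ⊆ Q} => ε Q * 𝒬.martingaleDiff Q f x) ∘ G
        = (fun m => 𝒬.increment ε f m x) ∘ ((↑) : A → ℤ) := by
      ext m
      simp only [Function.comp_apply, hG, martingaleDiff_cell m.2.1, increment]
    rw [e1, hasSum_subtype_iff_indicator]
    have e2 : A.indicator (fun m => 𝒬.increment ε f m x)
        = {m : ℤ | Q' ⊆ 𝒬.cell m x}.indicator fun m => 𝒬.increment ε f m x := by
      ext m
      by_cases hm : Q' ⊆ 𝒬.cell m x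
      · by_cases hj : 𝒬.cell (m + 1) x = 𝒬.cell m x
        · rw [Set.indicator_of_notMem (fun h => h.1 hj), Set.indicator_of_mem hm,
            increment_eq_zero hj]
        · rw [Set.indicator_of_mem (show m ∈ A from ⟨hj, hm⟩), Set.indicator_of_mem hm]
      · rw [Set.indicator_of_notMem (fun h => hm h.2), Set.indicator_of_notMem hm]
    rw [e2]
  · rintro ⟨Q, hQ, hQ'⟩ hnot
    by_contra hne
    obtain ⟨m, hm, hj⟩ := exists_cell_of_martingaleDiff_ne_zero hQ (right_ne_zero_of_mul hne)
    exact hnot ⟨⟨m, hj, hm ▸ hQ'⟩, Subtype.ext hm⟩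

theorem hasSum_indicator_Iio (hε : ∀ Q ∈ 𝒬.atoms, ‖ε Q‖ ≤ 1) (hQ₀ : Q₀ ∈ 𝒬.atoms)
    (hsupp : ∀ᵐ x ∂μ, x ∉ Q₀ → f x = 0) (n : ℤ) (x : Ω) :
    HasSum ((Set.Iio n).indicator fun m => 𝒬.increment ε f m x) (𝒬.prefixSum ε f n x) := by
  have hinj : Function.Injective fun j : ℕ => n - 1 - (j : ℤ) := fun i j h => by
    simp only at h; omega
  rw [← hinj.hasSum_iff]
  · have e : ((Set.Iio n).indicator fun m => 𝒬.increment ε f m x) ∘ (fun j : ℕ => n - 1 - (j : ℤ))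
        = fun j : ℕ => 𝒬.increment ε f (n - 1 - j) x := by
      ext j
      rw [Function.comp_apply, Set.indicator_of_mem (Set.mem_Iio.2 (by omega))]
    rw [e]
    exact (summable_increment hε hQ₀ hsupp n x).of_norm.hasSum
  · intro m hm
    refine Set.indicator_of_notMem (fun hlt => hm ⟨(n - 1 - m).toNat, ?_⟩) _
    have : m < n := hlt
    simp only; omega

theorem exists_eq_Iio {I : Set ℤ} (hI : IsLowerSet I) (hne : I.Nonempty) (hun : ∃ m, m ∉ I) :
    ∃ M, I = Set.Iio M := by
  obtain ⟨a, ha⟩ := hne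
  have hlt : ∀ m, m ∉ I → a ≤ m := fun m hm => le_of_not_ge fun h => hm (hI h ha)
  obtain ⟨M, hM, hmin⟩ := Int.exists_least_of_bdd (P := fun m => m ∉ I) ⟨a, hlt⟩ hun
  refine ⟨M, Set.ext fun m => ⟨fun hm => ?_, fun hm => ?_⟩⟩
  · exact lt_of_not_ge fun h => hM (hI h hm)
  · by_contra hcon
    exact absurd (hmin m hcon) (not_le.2 hm)

/-- Every truncation is a prefix sum or zero. -/
theorem hasSum_truncation (hε : ∀ Q ∈ 𝒬.atoms, ‖ε Q‖ ≤ 1) (hQ₀ : Q₀ ∈ 𝒬.atoms)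
    (hsupp : ∀ᵐ x ∂μ, x ∉ Q₀ → f x = 0) {n : ℤ} {Q' : Set Ω} (hQ' : Q' ∈ 𝒬.part n) (x : Ω) :
    (∃ M, (x ∈ Q' → n ≤ M) ∧
      HasSum (fun Q : {Q : Set Ω // Q ∈ 𝒬.atoms ∧ Q' ⊆ Q} => ε Q * 𝒬.martingaleDiff Q f x)
        (𝒬.prefixSum ε f M x)) ∨
    (x ∉ Q' ∧
      HasSum (fun Q : {Q : Set Ω // Q ∈ 𝒬.atoms ∧ Q' ⊆ Q} => ε Q * 𝒬.martingaleDiff Q f x) 0) := by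
  simp only [hasSum_truncation_iff]
  set I : Set ℤ := {m | Q' ⊆ 𝒬.cell m x} with hI
  have hlow : IsLowerSet I := fun a b hba ha => Set.Subset.trans ha (cell_antitone x hba)
  have hmem : x ∈ Q' → n ∈ I := fun hx => (cell_eq_of_mem hQ' hx).symm.subset
  rcases I.eq_empty_or_nonempty with hemp | hne
  · refine Or.inr ⟨fun hx => ?_, ?_⟩
    · have := hmem hx
      rw [hemp] at this
      exact this
    · rw [hemp, Set.indicator_empty]
      exact hasSum_zero
  left
  -- A nonempty lower set of integers is a ray or everything. In the second case the cells stay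
  -- equal to `Q'` from level `n` on, so the sum effectively ends at `n`.
  by_cases hun : ∃ m, m ∉ I
  · obtain ⟨M, hM⟩ := exists_eq_Iio hlow hne hun
    refine ⟨M, fun hx => ?_, ?_⟩
    · have := hmem hx
      rw [hM] at this
      exact (Set.mem_Iio.1 this).le
    · rw [hM]
      exact hasSum_indicator_Iio hε hQ₀ hsupp M x
  · push Not at hun
    have hcell : ∀ m, n ≤ m → 𝒬.cell m x = Q' := by
      intro m hm
      obtain ⟨y, hy⟩ := nonempty_of_mem_part hQ'
      have : 𝒬.cell n x = Q' := by
        rw [← cell_eq_of_mem hQ' hy]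
        exact (mem_cell_iff.1 (hun n hy)).symm
      exact Set.Subset.antisymm ((cell_antitone x hm).trans this.subset) (hun m)
    refine ⟨n, fun _ => le_rfl, ?_⟩
    have e : I.indicator (fun m => 𝒬.increment ε f m x)
        = (Set.Iio n).indicator fun m => 𝒬.increment ε f m x := by
      ext m
      rw [Set.indicator_of_mem (hun m)]
      by_cases hm : m < n
      · rw [Set.indicator_of_mem (Set.mem_Iio.2 hm)]
      · rw [Set.indicator_of_notMem (mt Set.mem_Iio.1 hm), increment_eq_zero]
        rw [hcell m (not_lt.1 hm), hcell (m + 1) (by omega)]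
    rw [e]
    exact hasSum_indicator_Iio hε hQ₀ hsupp n x

theorem ae_tendsto_truncation [SigmaFinite μ] (hε : ∀ Q ∈ 𝒬.atoms, ‖ε Q‖ ≤ 1)
    (hf : Integrable f μ) (hQ₀ : Q₀ ∈ 𝒬.atoms) (hsupp : ∀ᵐ x ∂μ, x ∉ Q₀ → f x = 0) :
    ∀ᵐ x ∂μ, Tendsto (fun n : ℤ => 𝒬.truncation ε f (𝒬.cell n x) x) atTop
      (𝓝 (𝒬.transform ε f x)) := by
  filter_upwards [ae_tendsto_prefixSum hε hf hQ₀ hsupp] with x ⟨c, hc⟩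
  have h : ∀ n, ∃ M, n ≤ M ∧ 𝒬.truncation ε f (𝒬.cell n x) x = 𝒬.prefixSum ε f M x := by
    intro n
    rcases hasSum_truncation hε hQ₀ hsupp (𝒬.cell_mem_part n x) x with ⟨M, hM, hs⟩ | ⟨hx, -⟩
    · exact ⟨M, hM (𝒬.mem_cell n x), hs.tsum_eq⟩
    · exact absurd (𝒬.mem_cell n x) hx
  -- `M n` may exceed `n` when the cell persists; `n ≤ M n` is what sends it to infinity.
  choose M hM hMe using h
  exact tendsto_nhds_limUnder ⟨c, (hc.comp (tendsto_atTop_mono hM tendsto_id)).congr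
    fun n => (hMe n).symm⟩

end Truncation

section Domination

theorem sparseOperator_mono {S S' : Set (Set Ω)} (h : S ⊆ S') (g : Ω → ℝ≥0∞) (x : Ω) :
    sparseOperator μ S g x ≤ sparseOperator μ S' g x :=
  ENNReal.tsum_mono_subtype (fun P : Set Ω => P.indicator (fun _ => ⨍⁻ y in P, g y ∂μ) x) h

/-- Past the level of `Q₀`, split there: the coarse part is at most the average over `Q₀`, exactly
the spare term in `enorm_sum_increment_add_le`. -/
theorem enorm_prefixSum_le_sparseOperator (hε : ∀ Q ∈ 𝒬.atoms, ‖ε Q‖ ≤ 1) (hf : Integrable f μ)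
    (hQ₀ : Q₀ ∈ 𝒬.atoms) (hsupp : ∀ᵐ x ∂μ, x ∉ Q₀ → f x = 0) (M : ℤ) {x : Ω} (hx : x ∈ Q₀) :
    ‖𝒬.prefixSum ε f M x‖ₑ ≤
      1123 * sparseOperator μ {R | 𝒬.StoppingFamily ε f Q₀ R} (fun y => ‖f y‖ₑ) x := by
  have key := enorm_sum_increment_add_le hε hf hQ₀ x M (M - 𝒬.level Q₀).toNat
    (.base : 𝒬.StoppingFamily ε f Q₀ Q₀) hx (by omega)
  refine le_trans ?_ (key.trans (mul_le_mul_right (sparseOperator_mono (fun R hR => hR.1) _ x) _))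
  have hcell : ∀ n ≤ 𝒬.level Q₀, Q₀ ⊆ 𝒬.cell n x := fun n hn => by
    rw [← cell_eq_of_mem (mem_part_level hQ₀) hx]
    exact cell_antitone x hn
  rcases le_total M (𝒬.level Q₀) with hle | hle
  · exact (enorm_prefixSum_le hε hf hQ₀ hsupp (hcell M hle)).trans le_add_self
  · obtain ⟨n, rfl⟩ := Int.le.dest hle
    rw [prefixSum_add hε hQ₀ hsupp, ← partialTransform_eq_sum_Ico, add_comm]
    exact (enorm_add_le _ _).trans
      (add_le_add_right (enorm_prefixSum_le hε hf hQ₀ hsupp (hcell _ le_rfl)) _)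

theorem enorm_truncation_le (hε : ∀ Q ∈ 𝒬.atoms, ‖ε Q‖ ≤ 1) (hf : Integrable f μ)
    (hQ₀ : Q₀ ∈ 𝒬.atoms) (hsupp : ∀ᵐ x ∂μ, x ∉ Q₀ → f x = 0) {Q' : Set Ω} (hQ' : Q' ∈ 𝒬.atoms)
    {x : Ω} (hx : x ∈ Q₀) : ‖𝒬.truncation ε f Q' x‖ₑ ≤
      1123 * sparseOperator μ {R | 𝒬.StoppingFamily ε f Q₀ R} (fun y => ‖f y‖ₑ) x := by
  obtain ⟨n, hn⟩ := exists_part hQ'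
  rcases hasSum_truncation (f := f) hε hQ₀ hsupp hn x with ⟨M, -, hs⟩ | ⟨-, hs⟩
  · rw [truncation, hs.tsum_eq]
    exact enorm_prefixSum_le_sparseOperator hε hf hQ₀ hsupp M hx
  · rw [truncation, hs.tsum_eq, enorm_zero]
    exact zero_le

end Domination

end PartitionFiltration

end

theorem theorem2p1 :
    ∃ C : ℝ≥0, 0 < C ∧
      ∀ (𝕜 : Type*) [RCLike 𝕜] (Ω : Type*) [MeasurableSpace Ω] (μ : Measure Ω) [SigmaFinite μ]
        (𝒬 : PartitionFiltration Ω μ) (Q₀ : Set Ω) (_ : Q₀ ∈ 𝒬.atoms)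
        (f : Ω → 𝕜) (_ : Integrable f μ) (_ : ∀ᵐ x ∂μ, x ∉ Q₀ → f x = 0)
        (ε : Set Ω → 𝕜) (_ : ∀ P ∈ 𝒬.atoms, ‖ε P‖ ≤ 1),
        -- the sums defining the truncations and the transform converge
        (∀ᵐ x ∂μ, ∀ Q' ∈ 𝒬.atoms,
          Summable (fun Q : {Q : Set Ω // Q ∈ 𝒬.atoms ∧ Q' ⊆ Q} =>
            ε Q * 𝒬.martingaleDiff Q f x)) ∧
        (∀ᵐ x ∂μ, Tendsto (fun n : ℤ => 𝒬.truncation ε f (𝒬.cell n x) x) atTop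
          (𝓝 (𝒬.transform ε f x))) ∧
        -- sparse domination
        ∃ S : Set (Set Ω), 𝒬.IsSparse S ∧
          (∀ᵐ x ∂μ, Q₀.indicator (fun x => ‖𝒬.transform ε f x‖ₑ) x ≤
            C * sparseOperator μ S (fun y => ‖f y‖ₑ) x) ∧
          (∀ᵐ x ∂μ, Q₀.indicator (𝒬.maximalTruncation ε f) x ≤
            C * sparseOperator μ S (fun y => ‖f y‖ₑ) x) := by
  refine ⟨1123, by norm_num, fun 𝕜 _ Ω _ μ _ 𝒬 Q₀ hQ₀ f hf hsupp ε hε => ?_⟩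
  have hconv := PartitionFiltration.ae_tendsto_truncation hε hf hQ₀ hsupp
  refine ⟨ae_of_all _ fun x Q' hQ' => ?_, hconv, {R | 𝒬.StoppingFamily ε f Q₀ R},
    PartitionFiltration.isSparse_stoppingFamily hε hf hQ₀, ?_, ae_of_all _ fun x => ?_⟩
  · obtain ⟨n, hn⟩ := PartitionFiltration.exists_part hQ'
    rcases PartitionFiltration.hasSum_truncation (f := f) hε hQ₀ hsupp hn x
      with ⟨M, -, hs⟩ | ⟨-, hs⟩
    · exact hs.summable
    · exact hs.summable
  · filter_upwards [hconv] with x hx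
    by_cases hxQ : x ∈ Q₀
    · rw [Set.indicator_of_mem hxQ]
      exact le_of_tendsto ((continuous_enorm.tendsto _).comp hx) (Eventually.of_forall fun n =>
        PartitionFiltration.enorm_truncation_le hε hf hQ₀ hsupp (𝒬.cell_mem_atoms n x) hxQ)
    · rw [Set.indicator_of_notMem hxQ]
      exact zero_le
  · by_cases hxQ : x ∈ Q₀
    · rw [Set.indicator_of_mem hxQ]
      exact iSup₂_le fun Q' hQ' =>
        PartitionFiltration.enorm_truncation_le hε hf hQ₀ hsupp hQ' hxQ
    · rw [Set.indicator_of_notMem hxQ]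
      exact zero_le
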